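/- **Theorem (Obliviousness of $\lambda_{\mathtt{OADT}\Psi}$).** Let $\Sigma$ be a well-typed global context, and let $e_1,e_2$ be expressions with $e_1\approx e_2$ (indistinguishable), $\Sigma;\cdot\vdash e_1:\tau_1$ and $\Sigma;\cdot\vdash e_2:\tau_2$ (both well-typed in the empty local context, possibly at different types). Then for every $n\ge 0$: 1. there is $e_1'$ with $\Sigma\vdash e_1\longrightarrow^n e_1'$ if and only if there is $e_2'$ with $\Sigma\vdash e_2\longrightarrow^n e_2'$; 2. whenever $\Sigma\vdash e_1\longrightarrow^n e_1'$ and $\Sigma\vdash e_2\longrightarrow^n e_2'$, then $e_1'\approx e_2'$. Here $\longrightarrow^n$ means reduction in exactly $n$ small steps, and the calculus is as follows (expressions up to $\alpha$-equivalence; $\mathrm{ite}(b,a,c)$ is $a$ if $b$ is true and $c$ otherwise; a hat marks oblivious things). *Syntax.* Types and expressions form one class: $e,\tau ::= \mathtt{unit}\mid\mathtt{bool}\mid\widehat{\mathtt{bool}}\mid\tau*\tau\mid\tau\,\hat+\,\tau\mid\Pi x{:}\tau,\tau\mid\Psi\hat T\mid x\mid T\mid()\mid b\mid\lambda x{:}\tau.e\mid\mathtt{let}\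 x=e\ \mathtt{in}\ e\mid e\,e\mid C\,e\mid\hat T\,e\mid\mathtt{if}\ e\ \mathtt{then}\ e\ \mathtt{else}\ e\mid\mathtt{mux}\ e\,e\,e\mid(e,e)\mid\langle e,e\rangle\mid\pi_b\,e\mid\widehat{\mathtt{inj}}_b\langle\tau\rangle\,e\mid\widehat{\mathtt{match}}\ e\ \mathtt{with}\ x\Rightarrow e\mid x\Rightarrow e\mid\mathtt{match}\ e\ \mathtt{with}\ \overline{C\,x\Rightarrow e}\mid\mathtt{s}\,e\mid[b]\mid[\mathtt{inj}_b\langle\hat w\rangle\,\hat v]$, where $b$ is a Boolean, $\langle e,e\rangle$ is a $\Psi$-pair, $\mathtt s$ is the Boolean section, and the constructor names of a $\mathtt{match}$ are distinct. Oblivious type values are $\hat w::=\mathtt{unit}\mid\widehat{\mathtt{bool}}\mid\hat w*\hat w\mid\hat w\,\hat+\,\hat w$; oblivious values are $\hat v::=()\mid[b]\mid(\hat v,\hat v)\mid[\mathtt{inj}_b\langle\hat w\rangle\,\hat v]$; values are $v::=\hat v\mid b\mid(v,v)\mid\langle v,v\rangle\mid\lambda x{:}\tau.e\mid C\,v$.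 The partial map $\Sigma$ sends names to (possibly recursive) definitions $\mathtt{data}\ T=\overline{C\,\tau}$ (distinct constructor names), $\mathtt{fn}\ x{:}\tau=e$, or $\mathtt{obliv}\ \hat T(x{:}\tau)=\tau'$. The judgment $\hat v\Leftarrow\hat w$ is generated by: $()\Leftarrow\mathtt{unit}$; $[b]\Leftarrow\widehat{\mathtt{bool}}$; $(\hat v_1,\hat v_2)\Leftarrow\hat w_1*\hat w_2$ if $\hat v_i\Leftarrow\hat w_i$ for $i=1,2$; $[\mathtt{inj}_b\langle\hat w_1\hat+\hat w_2\rangle\,\hat v]\Leftarrow\hat w_1\hat+\hat w_2$ if $\hat v\Leftarrow\mathrm{ite}(b,\hat w_1,\hat w_2)$. *Indistinguishability.* $\approx$ is the least relation that is closed under all term formers (with the same names, labels and literals on both sides) and satisfies $[b]\approx[b']$ and $[\mathtt{inj}_b\langle\hat w\rangle\,\hat v]\approx[\mathtt{inj}_{b'}\langle\hat w\rangle\,\hat v']$ for all $b,b',\hat w,\hat v,\hat v'$: the two sides differ only in the contents of boxed values. *Reduction.* Steps may be taken inside the evaluation contexts $[]*\tau$, $\hat w*[]$, $[]\hat+\tau$,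 $\hat w\hat+[]$, $\mathtt{let}\ x=[]\ \mathtt{in}\ e$, $e\,[]$, $[]\,v$, $C\,[]$, $\hat T\,[]$, $\mathtt{if}\ []\ \mathtt{then}\ e\ \mathtt{else}\ e$, $\mathtt{mux}\ []\,e\,e$, $\mathtt{mux}\ v\,[]\,e$, $\mathtt{mux}\ v\,v\,[]$, $([],e)$, $(v,[])$, $\langle[],e\rangle$, $\langle v,[]\rangle$, $\pi_b[]$, $\widehat{\mathtt{inj}}_b\langle[]\rangle e$, $\widehat{\mathtt{inj}}_b\langle\hat w\rangle[]$, $\widehat{\mathtt{match}}\ []\ \mathtt{with}\ x\Rightarrow e\mid x\Rightarrow e$, $\mathtt{match}\ []\ \mathtt{with}\ \overline{C\,x\Rightarrow e}$, $\mathtt s\,[]$, and the basic steps are: - $x\to e$ if $\mathtt{fn}\ x{:}\tau=e\in\Sigma$; $\hat T\,v\to[v/x]\tau'$ if $\mathtt{obliv}\ \hat T(x{:}\tau)=\tau'\in\Sigma$; - $(\lambda x{:}\tau.e)\,v\to[v/x]e$; $\mathtt{let}\ x=v\ \mathtt{in}\ e\to[v/x]e$; - $\mathtt{if}\ b\ \mathtt{then}\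 e_1\ \mathtt{else}\ e_2\to\mathrm{ite}(b,e_1,e_2)$; $\mathtt{mux}\ [b]\,v_1\,v_2\to\mathrm{ite}(b,v_1,v_2)$; - $\mathtt{match}\ C_i\,v\ \mathtt{with}\ \overline{C\,x\Rightarrow e}\to[v/x]e_i$; $\pi_b(v_1,v_2)\to\mathrm{ite}(b,v_1,v_2)$; $\pi_b\langle v_1,v_2\rangle\to\mathrm{ite}(b,v_1,v_2)$; - $\mathtt s\,b\to[b]$; $\widehat{\mathtt{inj}}_b\langle\hat w\rangle\,\hat v\to[\mathtt{inj}_b\langle\hat w\rangle\,\hat v]$; - $\widehat{\mathtt{match}}\ [\mathtt{inj}_b\langle\hat w_1\hat+\hat w_2\rangle\,\hat v]\ \mathtt{with}\ x\Rightarrow e_1\mid x\Rightarrow e_2\;\to\;\mathtt{mux}\ [b]\ \mathrm{ite}(b,[\hat v/x]e_1,[\hat v_1/x]e_1)\ \mathrm{ite}(b,[\hat v_2/x]e_2,[\hat v/x]e_2)$ for any $\hat v_1\Leftarrow\hat w_1$, $\hat v_2\Leftarrow\hat w_2$ (a nondeterministic choice). *Type equivalence.* $\tau\equiv\tau'$ is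 the equivalence relation generated by parallel reduction under $\Sigma$, in which any set of redexes of the above forms, anywhere in the expression, may be contracted simultaneously, where arguments, definienda, components and branches that are written $v,v_1,v_2$ above may be arbitrary expressions. *Kinds* $\kappa$ are $\mathsf A,\mathsf P,\mathsf O,\mathsf M$ (any, public, oblivious, mixed), ordered by $\mathsf A\sqsubseteq\mathsf P\sqsubseteq\mathsf M$ and $\mathsf A\sqsubseteq\mathsf O\sqsubseteq\mathsf M$. "Well-kinded" means having some kind. Kinding $\Gamma\vdash\tau::\kappa$ is upward closed in $\kappa$ and given by: $\mathtt{unit}::\mathsf A$; $\mathtt{bool}::\mathsf P$; $\widehat{\mathtt{bool}}::\mathsf O$; $T::\mathsf P$ for a data type $T$ of $\Sigma$; $\Psi\hat T::\mathsf M$ for an oblivious type $\hat T$ of $\Sigma$; $\hat T\,e::\mathsf O$ if $\mathtt{obliv}\ \hat T(x{:}\tau)=\tau'\in\Sigma$ and $e:\tau$; $\Pi x{:}\tau_1,\tau_2::\mathsf M$ if $\tau_1$, and $\tau_2$ under $x{:}\tau_1$, are well-kinded; $\tau_1*\tau_2::\kappa$ if both $\tau_i::\kappa$; $\tau_1\hat+\tau_2::\mathsf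 O$ if both $\tau_i::\mathsf O$; and $\mathtt{let}\ x=e\ \mathtt{in}\ \tau'$, $\mathtt{if}\ e_0\ \mathtt{then}\ \tau_1\ \mathtt{else}\ \tau_2$, $\mathtt{match}\ e_0\ \mathtt{with}\ \overline{C\,x\Rightarrow\tau'}$ have kind $\mathsf O$ if $e:\tau$ for some $\tau$ (respectively $e_0:\mathtt{bool}$; $e_0:T$ with $\mathtt{data}\ T=\overline{C\,\tau}\in\Sigma$) and all $\tau',\tau_1,\tau_2,\tau_i'$ have kind $\mathsf O$ in the context extended by the bound variable $x{:}\tau$ (respectively not extended; extended by $x{:}\tau_i$). *Typing* $\Gamma\vdash e:\tau$ is given by: - if $e:\tau$, $\tau\equiv\tau'$ and $\tau'$ is well-kinded, then $e:\tau'$; $():\mathtt{unit}$; $b:\mathtt{bool}$; local variables have the type given by $\Gamma$, global functions the one given by $\Sigma$; - $\lambda x{:}\tau_1.e:\Pi x{:}\tau_1,\tau_2$ if $\tau_1$ is well-kinded and $e:\tau_2$ under $x{:}\tau_1$; $e_2\,e_1:[e_1/x]\tau_2$ if $e_2:\Pi x{:}\tau_1,\tau_2$ and $e_1:\tau_1$;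 $\mathtt{let}\ x=e_1\ \mathtt{in}\ e_2:[e_1/x]\tau_2$ if $e_1:\tau_1$ and $e_2:\tau_2$ under $x{:}\tau_1$; - $(e_1,e_2):\tau_1*\tau_2$ if $e_i:\tau_i$; $\pi_b\,e:\mathrm{ite}(b,\tau_1,\tau_2)$ if $e:\tau_1*\tau_2$; - $\mathtt{if}\ e_0\ \mathtt{then}\ e_1\ \mathtt{else}\ e_2:[e_0/y]\tau$ if $e_0:\mathtt{bool}$, $e_1:[\mathtt{true}/y]\tau$, $e_2:[\mathtt{false}/y]\tau$ and $[e_0/y]\tau$ is well-kinded; - for $\mathtt{data}\ T=\overline{C\,\tau}\in\Sigma$: $C_i\,e:T$ if $e:\tau_i$; $\mathtt{match}\ e_0\ \mathtt{with}\ \overline{C\,x\Rightarrow e}:[e_0/y]\tau'$ if $e_0:T$, $e_i:[C_i\,x/y]\tau'$ under $x{:}\tau_i$ for all $i$, and $[e_0/y]\tau'$ is well-kinded; - for $\mathtt{obliv}\ \hat T(x{:}\tau)=\tau'\in\Sigma$: $\langle e_1,e_2\rangle:\Psi\hat T$ if $e_1:\tau$ and $e_2:\hat T\,e_1$; if $e:\Psi\hat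 T$ then $\pi_1e:\tau$ and $\pi_2e:\hat T(\pi_1e)$ (where $\pi_1=\pi_{\mathtt{true}}$, $\pi_2=\pi_{\mathtt{false}}$); - $\mathtt{mux}\ e_0\,e_1\,e_2:\tau$ if $e_0:\widehat{\mathtt{bool}}$, $\tau::\mathsf O$ and $e_1,e_2:\tau$; $\mathtt s\,e:\widehat{\mathtt{bool}}$ if $e:\mathtt{bool}$; $[b]:\widehat{\mathtt{bool}}$; - $\widehat{\mathtt{inj}}_b\langle\tau_1\hat+\tau_2\rangle\,e:\tau_1\hat+\tau_2$ if $e:\mathrm{ite}(b,\tau_1,\tau_2)$ and $\tau_1\hat+\tau_2::\mathsf O$; $\widehat{\mathtt{match}}\ e_0\ \mathtt{with}\ x\Rightarrow e_1\mid x\Rightarrow e_2:\tau$ if $e_0:\tau_1\hat+\tau_2$, $\tau::\mathsf O$, and $e_i:\tau$ under $x{:}\tau_i$; $[\mathtt{inj}_b\langle\hat w\rangle\,\hat v]:\hat w$ if $[\mathtt{inj}_b\langle\hat w\rangle\,\hat v]\Leftarrow\hat w$. *Well-typed global context.* Every definition of $\Sigma$ satisfies, under $\Sigma$ itself: for $\mathtt{fn}\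 x{:}\tau=e$, $\cdot\vdash\tau$ is well-kinded and $\cdot\vdash e:\tau$; for $\mathtt{data}\ T=\overline{C\,\tau}$, $\cdot\vdash\tau_i::\mathsf P$ for all $i$; for $\mathtt{obliv}\ \hat T(x{:}\tau)=\tau'$, $\cdot\vdash\tau::\mathsf P$ and $x{:}\tau\vdash\tau'::\mathsf O$. -/

import Mathlib

/-! # The core calculus of oblivious algebraic data types with Psi-types

Types and expressions share one syntactic class.  Local variables are de Bruijn indices
(so alpha-equivalent expressions are equal); a binder binds index `0` of its body.  Global
definitions are referred to by name. -/

namespace OADT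

/-- Names of global definitions (functions, algebraic data types, oblivious types). -/
abbrev Name := ℕ

/-- Names of data constructors. -/
abbrev CName := ℕ

/-- Oblivious type values `ω ::= unit | ~bool | ω * ω | ω ~+ ω`. -/
inductive OTy : Type
  | unit : OTy
  | obool : OTy
  | prod (w₁ w₂ : OTy) : OTy
  | osum (w₁ w₂ : OTy) : OTy

/-- Oblivious values `u ::= () | [b] | (u, u) | [inj_b<ω> u]`. -/
inductive OVal : Type
  | unit : OVal
  | boxLit (b : Bool) : OVal
  | pair (u₁ u₂ : OVal) : OVal
  | boxInj (b : Bool) (w : OTy) (u : OVal) : OVal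

/-- Expressions and types.  The Boolean index of `proj`, `oinj` and `boxInj` is `true` for the
first component (left injection) and `false` for the second component (right injection). -/
inductive Exp : Type
  -- types: `unit`, `bool`, `~bool`, `τ * τ`, `τ ~+ τ`, `Π x : τ, τ`, `Ψ T`, and an ADT name `T`
  | unitT : Exp
  | boolT : Exp
  | oboolT : Exp
  | prod (t₁ t₂ : Exp) : Exp
  | osum (t₁ t₂ : Exp) : Exp
  | pi (t₁ t₂ : Exp) : Exp
  | psi (T : Name) : Exp
  | adt (T : Name) : Exp
  -- local variable, name of a global function, `()`, and Boolean literal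
  | var (k : ℕ) : Exp
  | gfun (x : Name) : Exp
  | unit : Exp
  | lit (b : Bool) : Exp
  -- `λ x : τ. e`, `let x = e in e`, application, `C e`, and oblivious type application `T e`
  | lam (t e : Exp) : Exp
  | letE (e₁ e₂ : Exp) : Exp
  | app (e₁ e₂ : Exp) : Exp
  | ctor (C : CName) (e : Exp) : Exp
  | oapp (T : Name) (e : Exp) : Exp
  -- public and oblivious conditional
  | ite (e₀ e₁ e₂ : Exp) : Exp
  | mux (e₀ e₁ e₂ : Exp) : Exp
  -- pair, Psi-pair, and projection (for both kinds of pairs)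
  | pair (e₁ e₂ : Exp) : Exp
  | psiPair (e₁ e₂ : Exp) : Exp
  | proj (b : Bool) (e : Exp) : Exp
  -- oblivious injection `~inj_b<τ> e` and its elimination `~match e with x => e | x => e`
  | oinj (b : Bool) (t e : Exp) : Exp
  | omatch (e₀ e₁ e₂ : Exp) : Exp
  -- `match e with C₁ x => e₁ | ... | Cₙ x => eₙ` with pairwise distinct constructor names
  | cases (n : ℕ) (C : Fin n ↪ CName) (e₀ : Exp) (es : Fin n → Exp) : Exp
  -- Boolean section `~bool#s e`
  | sec (e : Exp) : Exp
  -- run-time boxed values `[b]` and `[inj_b<ω> u]`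
  | boxLit (b : Bool) : Exp
  | boxInj (b : Bool) (w : OTy) (u : OVal) : Exp

/-- An oblivious type value as an expression. -/
def OTy.toExp : OTy → Exp
  | .unit => .unitT
  | .obool => .oboolT
  | .prod w₁ w₂ => .prod w₁.toExp w₂.toExp
  | .osum w₁ w₂ => .osum w₁.toExp w₂.toExp

/-- An oblivious value as an expression. -/
def OVal.toExp : OVal → Exp
  | .unit => .unit
  | .boxLit b => .boxLit b
  | .pair u₁ u₂ => .pair u₁.toExp u₂.toExp
  | .boxInj b w u => .boxInj b w u

/-! ## Substitution -/

/-- Extend a renaming under one binder. -/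
def upRen (r : ℕ → ℕ) : ℕ → ℕ
  | 0 => 0
  | k + 1 => r k + 1

/-- Renaming of local variables. -/
def Exp.rename : (ℕ → ℕ) → Exp → Exp
  | _, .unitT => .unitT
  | _, .boolT => .boolT
  | _, .oboolT => .oboolT
  | r, .prod t₁ t₂ => .prod (t₁.rename r) (t₂.rename r)
  | r, .osum t₁ t₂ => .osum (t₁.rename r) (t₂.rename r)
  | r, .pi t₁ t₂ => .pi (t₁.rename r) (t₂.rename (upRen r))
  | _, .psi T => .psi T
  | _, .adt T => .adt T
  | r, .var k => .var (r k)
  | _, .gfun x => .gfun x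
  | _, .unit => .unit
  | _, .lit b => .lit b
  | r, .lam t e => .lam (t.rename r) (e.rename (upRen r))
  | r, .letE e₁ e₂ => .letE (e₁.rename r) (e₂.rename (upRen r))
  | r, .app e₁ e₂ => .app (e₁.rename r) (e₂.rename r)
  | r, .ctor C e => .ctor C (e.rename r)
  | r, .oapp T e => .oapp T (e.rename r)
  | r, .ite e₀ e₁ e₂ => .ite (e₀.rename r) (e₁.rename r) (e₂.rename r)
  | r, .mux e₀ e₁ e₂ => .mux (e₀.rename r) (e₁.rename r) (e₂.rename r)
  | r, .pair e₁ e₂ => .pair (e₁.rename r) (e₂.rename r)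
  | r, .psiPair e₁ e₂ => .psiPair (e₁.rename r) (e₂.rename r)
  | r, .proj b e => .proj b (e.rename r)
  | r, .oinj b t e => .oinj b (t.rename r) (e.rename r)
  | r, .omatch e₀ e₁ e₂ =>
      .omatch (e₀.rename r) (e₁.rename (upRen r)) (e₂.rename (upRen r))
  | r, .cases n C e₀ es => .cases n C (e₀.rename r) (fun i => (es i).rename (upRen r))
  | r, .sec e => .sec (e.rename r)
  | _, .boxLit b => .boxLit b
  | _, .boxInj b w u => .boxInj b w u

/-- Weakening by one fresh innermost variable. -/
def Exp.shift (e : Exp) : Exp := e.rename (· + 1)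

/-- Extend a simultaneous substitution by a value for index `0`. -/
def scons (a : Exp) (s : ℕ → Exp) : ℕ → Exp
  | 0 => a
  | k + 1 => s k

/-- Extend a simultaneous substitution under one binder. -/
def up (s : ℕ → Exp) : ℕ → Exp := scons (.var 0) (fun k => (s k).shift)

/-- Simultaneous capture-avoiding substitution. -/
def Exp.subst : (ℕ → Exp) → Exp → Exp
  | _, .unitT => .unitT
  | _, .boolT => .boolT
  | _, .oboolT => .oboolT
  | s, .prod t₁ t₂ => .prod (t₁.subst s) (t₂.subst s)
  | s, .osum t₁ t₂ => .osum (t₁.subst s) (t₂.subst s)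
  | s, .pi t₁ t₂ => .pi (t₁.subst s) (t₂.subst (up s))
  | _, .psi T => .psi T
  | _, .adt T => .adt T
  | s, .var k => s k
  | _, .gfun x => .gfun x
  | _, .unit => .unit
  | _, .lit b => .lit b
  | s, .lam t e => .lam (t.subst s) (e.subst (up s))
  | s, .letE e₁ e₂ => .letE (e₁.subst s) (e₂.subst (up s))
  | s, .app e₁ e₂ => .app (e₁.subst s) (e₂.subst s)
  | s, .ctor C e => .ctor C (e.subst s)
  | s, .oapp T e => .oapp T (e.subst s)
  | s, .ite e₀ e₁ e₂ => .ite (e₀.subst s) (e₁.subst s) (e₂.subst s)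
  | s, .mux e₀ e₁ e₂ => .mux (e₀.subst s) (e₁.subst s) (e₂.subst s)
  | s, .pair e₁ e₂ => .pair (e₁.subst s) (e₂.subst s)
  | s, .psiPair e₁ e₂ => .psiPair (e₁.subst s) (e₂.subst s)
  | s, .proj b e => .proj b (e.subst s)
  | s, .oinj b t e => .oinj b (t.subst s) (e.subst s)
  | s, .omatch e₀ e₁ e₂ => .omatch (e₀.subst s) (e₁.subst (up s)) (e₂.subst (up s))
  | s, .cases n C e₀ es => .cases n C (e₀.subst s) (fun i => (es i).subst (up s))
  | s, .sec e => .sec (e.subst s)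
  | _, .boxLit b => .boxLit b
  | _, .boxInj b w u => .boxInj b w u

/-- `e.inst a` is `[a/x]e`, where `x` is the variable with index `0` of `e`. -/
def Exp.inst (e a : Exp) : Exp := e.subst (scons a .var)

/-- `t.instCtor C` is `[C x/y]t`: the variable `y` (index `0` of `t`) is replaced by `C x`, where
`x` is a new variable, which takes over index `0`. -/
def Exp.instCtor (t : Exp) (C : CName) : Exp :=
  t.subst (scons (.ctor C (.var 0)) (fun k => .var (k + 1)))

/-! ## Global definitions -/

/-- Global definitions. -/
inductive GDef : Type
  /-- `data T = C₁ τ₁ | ... | Cₙ τₙ`, with pairwise distinct constructor names -/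
  | data (n : ℕ) (C : Fin n ↪ CName) (ts : Fin n → Exp) : GDef
  /-- `fn x : τ = e` -/
  | fn (t e : Exp) : GDef
  /-- `obliv T (x : τ) = τ'`, where `x` is index `0` of `τ'` -/
  | obliv (t t' : Exp) : GDef

/-- A global context: a partial map from names to global definitions. -/
abbrev GCtx := Name → Option GDef

/-! ## Operational semantics -/

/-- Values. -/
inductive Value : Exp → Prop
  | unit : Value .unit
  | boxLit (b : Bool) : Value (.boxLit b)
  | boxInj (b : Bool) (w : OTy) (u : OVal) : Value (.boxInj b w u)
  | lit (b : Bool) : Value (.lit b)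
  | pair {v₁ v₂ : Exp} : Value v₁ → Value v₂ → Value (.pair v₁ v₂)
  | psiPair {v₁ v₂ : Exp} : Value v₁ → Value v₂ → Value (.psiPair v₁ v₂)
  | lam (t e : Exp) : Value (.lam t e)
  | ctor (C : CName) {v : Exp} : Value v → Value (.ctor C v)

/-- Oblivious value synthesis `u ⇐ ω`. -/
inductive OValTy : OVal → OTy → Prop
  | unit : OValTy .unit .unit
  | obool (b : Bool) : OValTy (.boxLit b) .obool
  | prod {u₁ u₂ : OVal} {w₁ w₂ : OTy} :
      OValTy u₁ w₁ → OValTy u₂ w₂ → OValTy (.pair u₁ u₂) (.prod w₁ w₂)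
  | osum {b : Bool} {u : OVal} {w₁ w₂ : OTy} :
      OValTy u (cond b w₁ w₂) → OValTy (.boxInj b (.osum w₁ w₂) u) (.osum w₁ w₂)

/-- Small-step reduction under a global context.  The rules whose names start with `c` are the
congruence rules, one for each form of evaluation context. -/
inductive Step (S : GCtx) : Exp → Exp → Prop
  -- evaluation contexts
  | cProd₁ {t₁ t₁' t₂ : Exp} : Step S t₁ t₁' → Step S (.prod t₁ t₂) (.prod t₁' t₂)
  | cProd₂ {w : OTy} {t₂ t₂' : Exp} :
      Step S t₂ t₂' → Step S (.prod w.toExp t₂) (.prod w.toExp t₂')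
  | cOSum₁ {t₁ t₁' t₂ : Exp} : Step S t₁ t₁' → Step S (.osum t₁ t₂) (.osum t₁' t₂)
  | cOSum₂ {w : OTy} {t₂ t₂' : Exp} :
      Step S t₂ t₂' → Step S (.osum w.toExp t₂) (.osum w.toExp t₂')
  | cLet {e₁ e₁' e₂ : Exp} : Step S e₁ e₁' → Step S (.letE e₁ e₂) (.letE e₁' e₂)
  | cApp₂ {e₁ e₂ e₂' : Exp} : Step S e₂ e₂' → Step S (.app e₁ e₂) (.app e₁ e₂')
  | cApp₁ {e₁ e₁' v : Exp} : Value v → Step S e₁ e₁' → Step S (.app e₁ v) (.app e₁' v)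
  | cCtor {C : CName} {e e' : Exp} : Step S e e' → Step S (.ctor C e) (.ctor C e')
  | cOApp {T : Name} {e e' : Exp} : Step S e e' → Step S (.oapp T e) (.oapp T e')
  | cIte {e₀ e₀' e₁ e₂ : Exp} : Step S e₀ e₀' → Step S (.ite e₀ e₁ e₂) (.ite e₀' e₁ e₂)
  | cMux₀ {e₀ e₀' e₁ e₂ : Exp} : Step S e₀ e₀' → Step S (.mux e₀ e₁ e₂) (.mux e₀' e₁ e₂)
  | cMux₁ {v₀ e₁ e₁' e₂ : Exp} :
      Value v₀ → Step S e₁ e₁' → Step S (.mux v₀ e₁ e₂) (.mux v₀ e₁' e₂)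
  | cMux₂ {v₀ v₁ e₂ e₂' : Exp} :
      Value v₀ → Value v₁ → Step S e₂ e₂' → Step S (.mux v₀ v₁ e₂) (.mux v₀ v₁ e₂')
  | cPair₁ {e₁ e₁' e₂ : Exp} : Step S e₁ e₁' → Step S (.pair e₁ e₂) (.pair e₁' e₂)
  | cPair₂ {v₁ e₂ e₂' : Exp} :
      Value v₁ → Step S e₂ e₂' → Step S (.pair v₁ e₂) (.pair v₁ e₂')
  | cPsiPair₁ {e₁ e₁' e₂ : Exp} : Step S e₁ e₁' → Step S (.psiPair e₁ e₂) (.psiPair e₁' e₂)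
  | cPsiPair₂ {v₁ e₂ e₂' : Exp} :
      Value v₁ → Step S e₂ e₂' → Step S (.psiPair v₁ e₂) (.psiPair v₁ e₂')
  | cProj {b : Bool} {e e' : Exp} : Step S e e' → Step S (.proj b e) (.proj b e')
  | cOInj₁ {b : Bool} {t t' e : Exp} : Step S t t' → Step S (.oinj b t e) (.oinj b t' e)
  | cOInj₂ {b : Bool} {w : OTy} {e e' : Exp} :
      Step S e e' → Step S (.oinj b w.toExp e) (.oinj b w.toExp e')
  | cOMatch {e₀ e₀' e₁ e₂ : Exp} :
      Step S e₀ e₀' → Step S (.omatch e₀ e₁ e₂) (.omatch e₀' e₁ e₂)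
  | cCases {n : ℕ} {C : Fin n ↪ CName} {e₀ e₀' : Exp} {es : Fin n → Exp} :
      Step S e₀ e₀' → Step S (.cases n C e₀ es) (.cases n C e₀' es)
  | cSec {e e' : Exp} : Step S e e' → Step S (.sec e) (.sec e')
  -- reduction rules
  | fn {x : Name} {t e : Exp} : S x = some (.fn t e) → Step S (.gfun x) e
  | oadt {T : Name} {t t' v : Exp} :
      S T = some (.obliv t t') → Value v → Step S (.oapp T v) (t'.inst v)
  | app {t e v : Exp} : Value v → Step S (.app (.lam t e) v) (e.inst v)
  | letE {v e : Exp} : Value v → Step S (.letE v e) (e.inst v)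
  | ite {b : Bool} {e₁ e₂ : Exp} : Step S (.ite (.lit b) e₁ e₂) (cond b e₁ e₂)
  | mux {b : Bool} {v₁ v₂ : Exp} :
      Value v₁ → Value v₂ → Step S (.mux (.boxLit b) v₁ v₂) (cond b v₁ v₂)
  | cases {n : ℕ} {C : Fin n ↪ CName} {i : Fin n} {v : Exp} {es : Fin n → Exp} :
      Value v → Step S (.cases n C (.ctor (C i) v) es) ((es i).inst v)
  | proj {b : Bool} {v₁ v₂ : Exp} :
      Value v₁ → Value v₂ → Step S (.proj b (.pair v₁ v₂)) (cond b v₁ v₂)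
  | psiProj {b : Bool} {v₁ v₂ : Exp} :
      Value v₁ → Value v₂ → Step S (.proj b (.psiPair v₁ v₂)) (cond b v₁ v₂)
  | sec {b : Bool} : Step S (.sec (.lit b)) (.boxLit b)
  | oinj {b : Bool} {w : OTy} {u : OVal} : Step S (.oinj b w.toExp u.toExp) (.boxInj b w u)
  | omatch {b : Bool} {w₁ w₂ : OTy} {u u₁ u₂ : OVal} {e₁ e₂ : Exp} :
      OValTy u₁ w₁ → OValTy u₂ w₂ →
      Step S (.omatch (.boxInj b (.osum w₁ w₂) u) e₁ e₂)
        (.mux (.boxLit b)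
          (cond b (e₁.inst u.toExp) (e₁.inst u₁.toExp))
          (cond b (e₂.inst u₂.toExp) (e₂.inst u.toExp)))

/-- `StepN S n e e'`: the expression `e` reduces to `e'` in exactly `n` steps. -/
inductive StepN (S : GCtx) : ℕ → Exp → Exp → Prop
  | zero (e : Exp) : StepN S 0 e e
  | succ {n : ℕ} {e e' e'' : Exp} : Step S e e' → StepN S n e' e'' → StepN S (n + 1) e e''

/-! ## Type equivalence -/

/-- Parallel reduction: any number of existing redexes (in any position, also under binders, and
without a restriction to values) are contracted simultaneously. -/
inductive Pared (S : GCtx) : Exp → Exp → Prop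
  | refl (e : Exp) : Pared S e e
  -- contraction
  | fn {x : Name} {t e : Exp} : S x = some (.fn t e) → Pared S (.gfun x) e
  | oadt {T : Name} {t t' e e' : Exp} :
      S T = some (.obliv t t') → Pared S e e' → Pared S (.oapp T e) (t'.inst e')
  | beta {t e₁ e₁' e₂ e₂' : Exp} :
      Pared S e₁ e₁' → Pared S e₂ e₂' → Pared S (.app (.lam t e₁) e₂) (e₁'.inst e₂')
  | letBeta {e₁ e₁' e₂ e₂' : Exp} :
      Pared S e₁ e₁' → Pared S e₂ e₂' → Pared S (.letE e₁ e₂) (e₂'.inst e₁')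
  | iteLit {b : Bool} {e₁ e₁' e₂ e₂' : Exp} :
      Pared S e₁ e₁' → Pared S e₂ e₂' → Pared S (.ite (.lit b) e₁ e₂) (cond b e₁' e₂')
  | muxBox {b : Bool} {e₁ e₁' e₂ e₂' : Exp} :
      Pared S e₁ e₁' → Pared S e₂ e₂' → Pared S (.mux (.boxLit b) e₁ e₂) (cond b e₁' e₂')
  | casesCtor {n : ℕ} {C : Fin n ↪ CName} {i : Fin n} {e e' : Exp} {es es' : Fin n → Exp} :
      Pared S e e' → (∀ j, Pared S (es j) (es' j)) →
      Pared S (.cases n C (.ctor (C i) e) es) ((es' i).inst e')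
  | projPair {b : Bool} {e₁ e₁' e₂ e₂' : Exp} :
      Pared S e₁ e₁' → Pared S e₂ e₂' → Pared S (.proj b (.pair e₁ e₂)) (cond b e₁' e₂')
  | projPsiPair {b : Bool} {e₁ e₁' e₂ e₂' : Exp} :
      Pared S e₁ e₁' → Pared S e₂ e₂' → Pared S (.proj b (.psiPair e₁ e₂)) (cond b e₁' e₂')
  | secLit {b : Bool} : Pared S (.sec (.lit b)) (.boxLit b)
  | oinjBox {b : Bool} {w : OTy} {u : OVal} :
      Pared S (.oinj b w.toExp u.toExp) (.boxInj b w u)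
  | omatchBox {b : Bool} {w₁ w₂ : OTy} {u u₁ u₂ : OVal} {e₁ e₁' e₂ e₂' : Exp} :
      OValTy u₁ w₁ → OValTy u₂ w₂ → Pared S e₁ e₁' → Pared S e₂ e₂' →
      Pared S (.omatch (.boxInj b (.osum w₁ w₂) u) e₁ e₂)
        (.mux (.boxLit b)
          (cond b (e₁'.inst u.toExp) (e₁'.inst u₁.toExp))
          (cond b (e₂'.inst u₂.toExp) (e₂'.inst u.toExp)))
  -- congruence
  | prod {t₁ t₁' t₂ t₂' : Exp} :
      Pared S t₁ t₁' → Pared S t₂ t₂' → Pared S (.prod t₁ t₂) (.prod t₁' t₂')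
  | osum {t₁ t₁' t₂ t₂' : Exp} :
      Pared S t₁ t₁' → Pared S t₂ t₂' → Pared S (.osum t₁ t₂) (.osum t₁' t₂')
  | pi {t₁ t₁' t₂ t₂' : Exp} :
      Pared S t₁ t₁' → Pared S t₂ t₂' → Pared S (.pi t₁ t₂) (.pi t₁' t₂')
  | lam {t t' e e' : Exp} : Pared S t t' → Pared S e e' → Pared S (.lam t e) (.lam t' e')
  | letE {e₁ e₁' e₂ e₂' : Exp} :
      Pared S e₁ e₁' → Pared S e₂ e₂' → Pared S (.letE e₁ e₂) (.letE e₁' e₂')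
  | app {e₁ e₁' e₂ e₂' : Exp} :
      Pared S e₁ e₁' → Pared S e₂ e₂' → Pared S (.app e₁ e₂) (.app e₁' e₂')
  | ctor {C : CName} {e e' : Exp} : Pared S e e' → Pared S (.ctor C e) (.ctor C e')
  | oapp {T : Name} {e e' : Exp} : Pared S e e' → Pared S (.oapp T e) (.oapp T e')
  | ite {e₀ e₀' e₁ e₁' e₂ e₂' : Exp} :
      Pared S e₀ e₀' → Pared S e₁ e₁' → Pared S e₂ e₂' →
      Pared S (.ite e₀ e₁ e₂) (.ite e₀' e₁' e₂')
  | mux {e₀ e₀' e₁ e₁' e₂ e₂' : Exp} :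
      Pared S e₀ e₀' → Pared S e₁ e₁' → Pared S e₂ e₂' →
      Pared S (.mux e₀ e₁ e₂) (.mux e₀' e₁' e₂')
  | pair {e₁ e₁' e₂ e₂' : Exp} :
      Pared S e₁ e₁' → Pared S e₂ e₂' → Pared S (.pair e₁ e₂) (.pair e₁' e₂')
  | psiPair {e₁ e₁' e₂ e₂' : Exp} :
      Pared S e₁ e₁' → Pared S e₂ e₂' → Pared S (.psiPair e₁ e₂) (.psiPair e₁' e₂')
  | proj {b : Bool} {e e' : Exp} : Pared S e e' → Pared S (.proj b e) (.proj b e')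
  | oinj {b : Bool} {t t' e e' : Exp} :
      Pared S t t' → Pared S e e' → Pared S (.oinj b t e) (.oinj b t' e')
  | omatch {e₀ e₀' e₁ e₁' e₂ e₂' : Exp} :
      Pared S e₀ e₀' → Pared S e₁ e₁' → Pared S e₂ e₂' →
      Pared S (.omatch e₀ e₁ e₂) (.omatch e₀' e₁' e₂')
  | cases {n : ℕ} {C : Fin n ↪ CName} {e₀ e₀' : Exp} {es es' : Fin n → Exp} :
      Pared S e₀ e₀' → (∀ j, Pared S (es j) (es' j)) →
      Pared S (.cases n C e₀ es) (.cases n C e₀' es')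
  | sec {e e' : Exp} : Pared S e e' → Pared S (.sec e) (.sec e')

/-- Type equivalence: the equivalence relation generated by parallel reduction. -/
def TyEquiv (S : GCtx) : Exp → Exp → Prop := Relation.EqvGen (Pared S)

/-! ## Kinding and typing -/

/-- Kinds: any, public, oblivious, mixed. -/
inductive Kind : Type
  | any : Kind
  | pub : Kind
  | obl : Kind
  | mix : Kind

/-- The order on kinds: `any` is the least, `mix` the greatest, `pub` and `obl` are incomparable. -/
inductive Kind.Le : Kind → Kind → Prop
  | refl (k : Kind) : Kind.Le k k
  | any_le (k : Kind) : Kind.Le .any k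
  | le_mix (k : Kind) : Kind.Le k .mix

/-- What a judgment assigns to an expression: a type (typing) or a kind (kinding). -/
inductive Cls : Type
  | ty (t : Exp) : Cls
  | kd (k : Kind) : Cls

/-- Typing contexts; the innermost variable comes first.  The entry for a variable lives in the
rest of the context to its right. -/
abbrev Ctx := List Exp

/-- The mutually dependent typing and kinding judgments, presented as one inductive family:
`Judg S G e (.ty t)` is the typing judgment `S; G ⊢ e : t`, and `Judg S G t (.kd k)` is the
kinding judgment `S; G ⊢ t :: k`. -/
inductive Judg (S : GCtx) : Ctx → Exp → Cls → Prop
  -- kinding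
  | kSub {G : Ctx} {t : Exp} {k k' : Kind} :
      Judg S G t (.kd k) → k.Le k' → Judg S G t (.kd k')
  | kUnit {G : Ctx} : Judg S G .unitT (.kd .any)
  | kBool {G : Ctx} : Judg S G .boolT (.kd .pub)
  | kOBool {G : Ctx} : Judg S G .oboolT (.kd .obl)
  | kADT {G : Ctx} {T : Name} {n : ℕ} {C : Fin n ↪ CName} {ts : Fin n → Exp} :
      S T = some (.data n C ts) → Judg S G (.adt T) (.kd .pub)
  | kOADT {G : Ctx} {T : Name} {t t' e : Exp} :
      S T = some (.obliv t t') → Judg S G e (.ty t) → Judg S G (.oapp T e) (.kd .obl)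
  | kPi {G : Ctx} {t₁ t₂ : Exp} {k₁ k₂ : Kind} :
      Judg S G t₁ (.kd k₁) → Judg S (t₁ :: G) t₂ (.kd k₂) → Judg S G (.pi t₁ t₂) (.kd .mix)
  | kProd {G : Ctx} {t₁ t₂ : Exp} {k : Kind} :
      Judg S G t₁ (.kd k) → Judg S G t₂ (.kd k) → Judg S G (.prod t₁ t₂) (.kd k)
  | kOSum {G : Ctx} {t₁ t₂ : Exp} :
      Judg S G t₁ (.kd .obl) → Judg S G t₂ (.kd .obl) → Judg S G (.osum t₁ t₂) (.kd .obl)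
  | kPsi {G : Ctx} {T : Name} {t t' : Exp} :
      S T = some (.obliv t t') → Judg S G (.psi T) (.kd .mix)
  | kLet {G : Ctx} {e t t' : Exp} :
      Judg S G e (.ty t) → Judg S (t :: G) t' (.kd .obl) → Judg S G (.letE e t') (.kd .obl)
  | kIf {G : Ctx} {e₀ t₁ t₂ : Exp} :
      Judg S G e₀ (.ty .boolT) → Judg S G t₁ (.kd .obl) → Judg S G t₂ (.kd .obl) →
      Judg S G (.ite e₀ t₁ t₂) (.kd .obl)
  | kMatch {G : Ctx} {T : Name} {n : ℕ} {C : Fin n ↪ CName} {ts ts' : Fin n → Exp} {e₀ : Exp} :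
      S T = some (.data n C ts) → Judg S G e₀ (.ty (.adt T)) →
      (∀ i, Judg S (ts i :: G) (ts' i) (.kd .obl)) →
      Judg S G (.cases n C e₀ ts') (.kd .obl)
  -- typing
  | tConv {G : Ctx} {e t t' : Exp} {k : Kind} :
      Judg S G e (.ty t) → TyEquiv S t t' → Judg S G t' (.kd k) → Judg S G e (.ty t')
  | tUnit {G : Ctx} : Judg S G .unit (.ty .unitT)
  | tLit {G : Ctx} {b : Bool} : Judg S G (.lit b) (.ty .boolT)
  | tVar {G : Ctx} {i : ℕ} {t : Exp} :
      G[i]? = some t → Judg S G (.var i) (.ty (t.rename (· + (i + 1))))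
  | tFun {G : Ctx} {x : Name} {t e : Exp} :
      S x = some (.fn t e) → Judg S G (.gfun x) (.ty t)
  | tAbs {G : Ctx} {t₁ t₂ e : Exp} {k : Kind} :
      Judg S (t₁ :: G) e (.ty t₂) → Judg S G t₁ (.kd k) → Judg S G (.lam t₁ e) (.ty (.pi t₁ t₂))
  | tApp {G : Ctx} {t₁ t₂ e₁ e₂ : Exp} :
      Judg S G e₂ (.ty (.pi t₁ t₂)) → Judg S G e₁ (.ty t₁) →
      Judg S G (.app e₂ e₁) (.ty (t₂.inst e₁))
  | tLet {G : Ctx} {t₁ t₂ e₁ e₂ : Exp} :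
      Judg S G e₁ (.ty t₁) → Judg S (t₁ :: G) e₂ (.ty t₂) →
      Judg S G (.letE e₁ e₂) (.ty (t₂.inst e₁))
  | tPair {G : Ctx} {t₁ t₂ e₁ e₂ : Exp} :
      Judg S G e₁ (.ty t₁) → Judg S G e₂ (.ty t₂) →
      Judg S G (.pair e₁ e₂) (.ty (.prod t₁ t₂))
  | tProj {G : Ctx} {b : Bool} {t₁ t₂ e : Exp} :
      Judg S G e (.ty (.prod t₁ t₂)) → Judg S G (.proj b e) (.ty (cond b t₁ t₂))
  -- in `tIf` and `tMatch` the result type is required to be well-kinded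
  | tIf {G : Ctx} {e₀ e₁ e₂ t : Exp} {k : Kind} :
      Judg S G e₀ (.ty .boolT) → Judg S G e₁ (.ty (t.inst (.lit true))) →
      Judg S G e₂ (.ty (t.inst (.lit false))) → Judg S G (t.inst e₀) (.kd k) →
      Judg S G (.ite e₀ e₁ e₂) (.ty (t.inst e₀))
  | tCtor {G : Ctx} {T : Name} {n : ℕ} {C : Fin n ↪ CName} {ts : Fin n → Exp} {i : Fin n}
      {e : Exp} :
      S T = some (.data n C ts) → Judg S G e (.ty (ts i)) →
      Judg S G (.ctor (C i) e) (.ty (.adt T))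
  | tMatch {G : Ctx} {T : Name} {n : ℕ} {C : Fin n ↪ CName} {ts : Fin n → Exp}
      {e₀ t' : Exp} {es : Fin n → Exp} {k : Kind} :
      S T = some (.data n C ts) → Judg S G e₀ (.ty (.adt T)) →
      (∀ i, Judg S (ts i :: G) (es i) (.ty (t'.instCtor (C i)))) →
      Judg S G (t'.inst e₀) (.kd k) →
      Judg S G (.cases n C e₀ es) (.ty (t'.inst e₀))
  | tPsiPair {G : Ctx} {T : Name} {t t' e₁ e₂ : Exp} :
      S T = some (.obliv t t') → Judg S G e₁ (.ty t) → Judg S G e₂ (.ty (.oapp T e₁)) →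
      Judg S G (.psiPair e₁ e₂) (.ty (.psi T))
  | tPsiProj₁ {G : Ctx} {T : Name} {t t' e : Exp} :
      S T = some (.obliv t t') → Judg S G e (.ty (.psi T)) → Judg S G (.proj true e) (.ty t)
  | tPsiProj₂ {G : Ctx} {T : Name} {t t' e : Exp} :
      S T = some (.obliv t t') → Judg S G e (.ty (.psi T)) →
      Judg S G (.proj false e) (.ty (.oapp T (.proj true e)))
  | tMux {G : Ctx} {t e₀ e₁ e₂ : Exp} :
      Judg S G e₀ (.ty .oboolT) → Judg S G t (.kd .obl) →
      Judg S G e₁ (.ty t) → Judg S G e₂ (.ty t) → Judg S G (.mux e₀ e₁ e₂) (.ty t)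
  | tOInj {G : Ctx} {b : Bool} {t₁ t₂ e : Exp} :
      Judg S G e (.ty (cond b t₁ t₂)) → Judg S G (.osum t₁ t₂) (.kd .obl) →
      Judg S G (.oinj b (.osum t₁ t₂) e) (.ty (.osum t₁ t₂))
  | tOMatch {G : Ctx} {t₁ t₂ t e₀ e₁ e₂ : Exp} :
      Judg S G e₀ (.ty (.osum t₁ t₂)) → Judg S G t (.kd .obl) →
      Judg S (t₁ :: G) e₁ (.ty t.shift) → Judg S (t₂ :: G) e₂ (.ty t.shift) →
      Judg S G (.omatch e₀ e₁ e₂) (.ty t)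
  | tSec {G : Ctx} {e : Exp} : Judg S G e (.ty .boolT) → Judg S G (.sec e) (.ty .oboolT)
  | tBoxLit {G : Ctx} {b : Bool} : Judg S G (.boxLit b) (.ty .oboolT)
  | tBoxInj {G : Ctx} {b : Bool} {w : OTy} {u : OVal} :
      OValTy (.boxInj b w u) w → Judg S G (.boxInj b w u) (.ty w.toExp)

/-- The typing judgment `S; G ⊢ e : t`. -/
abbrev HasType (S : GCtx) (G : Ctx) (e t : Exp) : Prop := Judg S G e (.ty t)

/-- The kinding judgment `S; G ⊢ t :: k`. -/
abbrev HasKind (S : GCtx) (G : Ctx) (t : Exp) (k : Kind) : Prop := Judg S G t (.kd k)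

/-- Well-typedness of a global definition. -/
inductive GDef.Ok (S : GCtx) : GDef → Prop
  | fn {t e : Exp} {k : Kind} : HasKind S [] t k → HasType S [] e t → GDef.Ok S (.fn t e)
  | data {n : ℕ} {C : Fin n ↪ CName} {ts : Fin n → Exp} :
      (∀ i, HasKind S [] (ts i) .pub) → GDef.Ok S (.data n C ts)
  | obliv {t t' : Exp} :
      HasKind S [] t .pub → HasKind S [t] t' .obl → GDef.Ok S (.obliv t t')

/-- A global context is well-typed if all its definitions are (under that same context, so that
recursive definitions are allowed). -/
def GCtx.Ok (S : GCtx) : Prop := ∀ (x : Name) (D : GDef), S x = some D → D.Ok S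

/-! ## Indistinguishability -/

/-- Two expressions are indistinguishable if they agree except for the contents of boxed values:
the bit of `[b]`, and the tag and payload (not the public type annotation) of `[inj_b<ω> u]`. -/
inductive Indist : Exp → Exp → Prop
  | boxLit (b b' : Bool) : Indist (.boxLit b) (.boxLit b')
  | boxInj (b b' : Bool) (w : OTy) (u u' : OVal) : Indist (.boxInj b w u) (.boxInj b' w u')
  | unitT : Indist .unitT .unitT
  | boolT : Indist .boolT .boolT
  | oboolT : Indist .oboolT .oboolT
  | prod {t₁ t₁' t₂ t₂' : Exp} :
      Indist t₁ t₁' → Indist t₂ t₂' → Indist (.prod t₁ t₂) (.prod t₁' t₂')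
  | osum {t₁ t₁' t₂ t₂' : Exp} :
      Indist t₁ t₁' → Indist t₂ t₂' → Indist (.osum t₁ t₂) (.osum t₁' t₂')
  | pi {t₁ t₁' t₂ t₂' : Exp} :
      Indist t₁ t₁' → Indist t₂ t₂' → Indist (.pi t₁ t₂) (.pi t₁' t₂')
  | psi (T : Name) : Indist (.psi T) (.psi T)
  | adt (T : Name) : Indist (.adt T) (.adt T)
  | var (k : ℕ) : Indist (.var k) (.var k)
  | gfun (x : Name) : Indist (.gfun x) (.gfun x)
  | unit : Indist .unit .unit
  | lit (b : Bool) : Indist (.lit b) (.lit b)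
  | lam {t t' e e' : Exp} : Indist t t' → Indist e e' → Indist (.lam t e) (.lam t' e')
  | letE {e₁ e₁' e₂ e₂' : Exp} :
      Indist e₁ e₁' → Indist e₂ e₂' → Indist (.letE e₁ e₂) (.letE e₁' e₂')
  | app {e₁ e₁' e₂ e₂' : Exp} :
      Indist e₁ e₁' → Indist e₂ e₂' → Indist (.app e₁ e₂) (.app e₁' e₂')
  | ctor (C : CName) {e e' : Exp} : Indist e e' → Indist (.ctor C e) (.ctor C e')
  | oapp (T : Name) {e e' : Exp} : Indist e e' → Indist (.oapp T e) (.oapp T e')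
  | ite {e₀ e₀' e₁ e₁' e₂ e₂' : Exp} :
      Indist e₀ e₀' → Indist e₁ e₁' → Indist e₂ e₂' → Indist (.ite e₀ e₁ e₂) (.ite e₀' e₁' e₂')
  | mux {e₀ e₀' e₁ e₁' e₂ e₂' : Exp} :
      Indist e₀ e₀' → Indist e₁ e₁' → Indist e₂ e₂' → Indist (.mux e₀ e₁ e₂) (.mux e₀' e₁' e₂')
  | pair {e₁ e₁' e₂ e₂' : Exp} :
      Indist e₁ e₁' → Indist e₂ e₂' → Indist (.pair e₁ e₂) (.pair e₁' e₂')
  | psiPair {e₁ e₁' e₂ e₂' : Exp} :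
      Indist e₁ e₁' → Indist e₂ e₂' → Indist (.psiPair e₁ e₂) (.psiPair e₁' e₂')
  | proj (b : Bool) {e e' : Exp} : Indist e e' → Indist (.proj b e) (.proj b e')
  | oinj (b : Bool) {t t' e e' : Exp} :
      Indist t t' → Indist e e' → Indist (.oinj b t e) (.oinj b t' e')
  | omatch {e₀ e₀' e₁ e₁' e₂ e₂' : Exp} :
      Indist e₀ e₀' → Indist e₁ e₁' → Indist e₂ e₂' →
      Indist (.omatch e₀ e₁ e₂) (.omatch e₀' e₁' e₂')
  | cases (n : ℕ) (C : Fin n ↪ CName) {e₀ e₀' : Exp} {es es' : Fin n → Exp} :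
      Indist e₀ e₀' → (∀ i, Indist (es i) (es' i)) →
      Indist (.cases n C e₀ es) (.cases n C e₀' es')
  | sec {e e' : Exp} : Indist e e' → Indist (.sec e) (.sec e')

end OADT

/-!
Reduction runs in lockstep on indistinguishable expressions. Whether an expression can step, and by
which rule, depends only on what indistinguishability preserves, so the only steps whose results
could differ are those that look into a box. A `mux` on `[b]` selects one of two values according
to the secret `b`; both are typed at one oblivious type, and all values of an oblivious type are
indistinguishable, because type equivalence pins down a single oblivious type value and the values
of the latter differ only inside boxes. An oblivious `match` steps to a `mux` whose branches
instantiate the same bodies with different values of the same oblivious types.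

The next step needs typing again, so types must be preserved by reduction. This is proved for
parallel reduction, which also generates type equivalence; inverting type equivalences uses its
confluence.
-/

namespace OADT

variable {S : GCtx}

/-! ### Substitution -/

@[simp] theorem upRen_succ (r : ℕ → ℕ) (k : ℕ) : upRen r (k + 1) = r k + 1 := rfl

@[simp] theorem scons_succ (a : Exp) (s : ℕ → Exp) (k : ℕ) : scons a s (k + 1) = s k := rfl

@[simp] theorem up_succ (s : ℕ → Exp) (k : ℕ) : up s (k + 1) = (s k).shift := rfl

theorem upRen_comp_upRen (r s : ℕ → ℕ) : upRen s ∘ upRen r = upRen (s ∘ r) := by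
  funext k; cases k <;> rfl

theorem up_comp_upRen (s : ℕ → Exp) (r : ℕ → ℕ) : up s ∘ upRen r = up (s ∘ r) := by
  funext k; cases k <;> rfl

theorem up_var_comp (r : ℕ → ℕ) : up (Exp.var ∘ r) = Exp.var ∘ upRen r := by
  funext k; cases k <;> rfl

theorem up_var : up Exp.var = Exp.var := by
  funext k; cases k <;> rfl

theorem Exp.rename_rename (e : Exp) (r s : ℕ → ℕ) :
    (e.rename r).rename s = e.rename (s ∘ r) := by
  induction e generalizing r s <;> simp [Exp.rename, upRen_comp_upRen, *]

theorem Exp.subst_rename (e : Exp) (r : ℕ → ℕ) (s : ℕ → Exp) :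
    (e.rename r).subst s = e.subst (s ∘ r) := by
  induction e generalizing r s <;> simp [Exp.rename, Exp.subst, up_comp_upRen, *]

theorem Exp.rename_shift (e : Exp) (r : ℕ → ℕ) :
    e.shift.rename (upRen r) = (e.rename r).shift := by
  simp only [Exp.shift, Exp.rename_rename]; rfl

theorem rename_comp_up (s : ℕ → Exp) (r : ℕ → ℕ) :
    (fun k => (up s k).rename (upRen r)) = up fun k => (s k).rename r := by
  funext k
  cases k with
  | zero => rfl
  | succ k => simp [Exp.rename_shift]

theorem Exp.rename_subst (e : Exp) (s : ℕ → Exp) (r : ℕ → ℕ) :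
    (e.subst s).rename r = e.subst fun k => (s k).rename r := by
  induction e generalizing r s <;> simp [Exp.rename, Exp.subst, rename_comp_up, *]

theorem Exp.subst_shift (e : Exp) (s : ℕ → Exp) : e.shift.subst (up s) = (e.subst s).shift := by
  simp only [Exp.shift, Exp.subst_rename, Exp.rename_subst]; rfl

theorem subst_comp_up (s t : ℕ → Exp) :
    (fun k => (up s k).subst (up t)) = up fun k => (s k).subst t := by
  funext k
  cases k with
  | zero => rfl
  | succ k => simp [Exp.subst_shift]

theorem Exp.subst_subst (e : Exp) (s t : ℕ → Exp) :
    (e.subst s).subst t = e.subst fun k => (s k).subst t := by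
  induction e generalizing s t <;> simp [Exp.subst, subst_comp_up, *]

theorem Exp.rename_eq_subst (e : Exp) (r : ℕ → ℕ) : e.rename r = e.subst (Exp.var ∘ r) := by
  induction e generalizing r <;> simp [Exp.rename, Exp.subst, up_var_comp, *]

@[simp] theorem Exp.subst_var (e : Exp) : e.subst Exp.var = e := by
  induction e <;> simp [Exp.subst, up_var, *]

theorem Exp.inst_shift (e a : Exp) : e.shift.inst a = e := by
  simp only [Exp.shift, Exp.inst, Exp.subst_rename]
  exact e.subst_var

theorem Exp.subst_inst (e a : Exp) (s : ℕ → Exp) :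
    (e.inst a).subst s = (e.subst (up s)).inst (a.subst s) := by
  simp only [Exp.inst, Exp.subst_subst]
  congr 1
  funext k
  cases k with
  | zero => rfl
  | succ k => exact (Exp.inst_shift (s k) (a.subst s)).symm

theorem Exp.subst_instCtor (e : Exp) (C : CName) (s : ℕ → Exp) :
    (e.instCtor C).subst (up s) = (e.subst (up s)).instCtor C := by
  simp only [Exp.instCtor, Exp.subst_subst]
  congr 1
  funext k
  cases k with
  | zero => rfl
  | succ k =>
    simp only [scons_succ, Exp.subst, up_succ, Exp.shift, Exp.subst_rename]
    exact Exp.rename_eq_subst _ _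

theorem Exp.inst_instCtor (e : Exp) (C : CName) (a : Exp) :
    (e.instCtor C).inst a = e.inst (.ctor C a) := by
  simp only [Exp.instCtor, Exp.inst, Exp.subst_subst]
  congr 1
  funext k
  cases k <;> rfl

theorem Exp.subst_cond (b : Bool) (x y : Exp) (s : ℕ → Exp) :
    (cond b x y).subst s = cond b (x.subst s) (y.subst s) := by
  cases b <;> rfl

/-! ### Oblivious values -/

@[simp] theorem OTy.subst_toExp (w : OTy) (s : ℕ → Exp) : w.toExp.subst s = w.toExp := by
  induction w <;> simp [OTy.toExp, Exp.subst, *]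

@[simp] theorem OVal.subst_toExp (u : OVal) (s : ℕ → Exp) : u.toExp.subst s = u.toExp := by
  induction u <;> simp [OVal.toExp, Exp.subst, *]

theorem OTy.toExp_injective : Function.Injective OTy.toExp := by
  intro w
  induction w with
  | unit | obool => intro w' h; cases w' <;> simp_all [OTy.toExp]
  | prod _ _ ih₁ ih₂ | osum _ _ ih₁ ih₂ =>
    intro w' h
    cases w' <;> simp only [OTy.toExp, Exp.prod.injEq, Exp.osum.injEq, reduceCtorEq] at h
    rw [ih₁ h.1, ih₂ h.2]

theorem OVal.toExp_injective : Function.Injective OVal.toExp := by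
  intro u
  induction u with
  | unit | boxLit | boxInj => intro u' h; cases u' <;> simp_all [OVal.toExp]
  | pair _ _ ih₁ ih₂ =>
    intro u' h
    cases u' <;> simp only [OVal.toExp, Exp.pair.injEq, reduceCtorEq] at h
    rw [ih₁ h.1, ih₂ h.2]

theorem OTy.exists_ovalTy (w : OTy) : ∃ u, OValTy u w := by
  induction w with
  | unit => exact ⟨_, .unit⟩
  | obool => exact ⟨_, .obool true⟩
  | prod _ _ ih₁ ih₂ =>
    obtain ⟨⟨_, h₁⟩, ⟨_, h₂⟩⟩ := And.intro ih₁ ih₂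
    exact ⟨_, .prod h₁ h₂⟩
  | osum _ _ ih₁ _ =>
    obtain ⟨_, h₁⟩ := ih₁
    exact ⟨_, .osum (b := true) h₁⟩

/-! ### Indistinguishability -/

theorem Indist.refl (e : Exp) : Indist e e := by
  induction e <;> constructor <;> assumption

theorem Indist.symm {e e' : Exp} (h : Indist e e') : Indist e' e := by
  induction h <;> constructor <;> assumption

theorem Indist.trans {e₁ e₂ e₃ : Exp} (h : Indist e₁ e₂) (h' : Indist e₂ e₃) :
    Indist e₁ e₃ := by
  induction h generalizing e₃ <;> cases h' <;> constructor <;> solve_by_elim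

theorem Indist.rename {e e' : Exp} (h : Indist e e') (r : ℕ → ℕ) :
    Indist (e.rename r) (e'.rename r) := by
  induction h generalizing r <;> simp only [Exp.rename] <;> constructor <;> solve_by_elim

theorem Indist.up {s s' : ℕ → Exp} (h : ∀ k, Indist (s k) (s' k)) (k : ℕ) :
    Indist (up s k) (up s' k) := by
  cases k with
  | zero => exact .refl _
  | succ k => exact (h k).rename _

theorem Indist.subst {e e' : Exp} (h : Indist e e') {s s' : ℕ → Exp}
    (hs : ∀ k, Indist (s k) (s' k)) : Indist (e.subst s) (e'.subst s') := by
  induction h generalizing s s' with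
  | var k => exact hs k
  | _ => simp only [Exp.subst]; constructor <;> solve_by_elim [Indist.up]

theorem Indist.inst {e e' a a' : Exp} (h : Indist e e') (ha : Indist a a') :
    Indist (e.inst a) (e'.inst a') :=
  h.subst fun
    | 0 => ha
    | _ + 1 => .refl _

theorem Indist.cond {x x' y y' : Exp} (hx : Indist x x') (hy : Indist y y') (b : Bool) :
    Indist (cond b x y) (cond b x' y') := by
  cases b <;> assumption

theorem OValTy.indist {u u' : OVal} {w : OTy} (h : OValTy u w) (h' : OValTy u' w) :
    Indist u.toExp u'.toExp := by
  induction h generalizing u' with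
  | unit => cases h'; exact .refl _
  | obool b => cases h'; exact .boxLit _ _
  | prod _ _ ih₁ ih₂ =>
    cases h' with
    | prod h₁ h₂ => exact .pair (ih₁ h₁) (ih₂ h₂)
  | osum _ _ => cases h'; exact .boxInj _ _ _ _ _

/-! ### Parallel reduction and substitution -/

/-- The definitions of a global context are closed: substitutions do not affect them (apart from
the parameter of an oblivious type, which is index `0` of its body). -/
structure GCtx.Closed (S : GCtx) : Prop where
  fn {x : Name} {t e : Exp} : S x = some (.fn t e) →
    ∀ s : ℕ → Exp, t.subst s = t ∧ e.subst s = e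
  data {T : Name} {n : ℕ} {C : Fin n ↪ CName} {ts : Fin n → Exp} :
    S T = some (.data n C ts) → ∀ (i : Fin n) (s : ℕ → Exp), (ts i).subst s = ts i
  obliv {T : Name} {t t' : Exp} : S T = some (.obliv t t') →
    ∀ s : ℕ → Exp, t.subst s = t ∧ t'.subst (up s) = t'

theorem Pared.cond {x x' y y' : Exp} (hx : Pared S x x') (hy : Pared S y y') (b : Bool) :
    Pared S (cond b x y) (cond b x' y') := by
  cases b <;> assumption

section Subst

variable {R : (ℕ → Exp) → (ℕ → Exp) → Prop} {s s' : ℕ → Exp}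

theorem Pared.subst_refl_of_stable (hR : ∀ {s s'}, R s s' → ∀ k, Pared S (s k) (s' k))
    (hup : ∀ {s s'}, R s s' → R (up s) (up s')) (e : Exp) (hs : R s s') :
    Pared S (e.subst s) (e.subst s') := by
  induction e generalizing s s' with
  | var k => exact hR hs k
  | unitT | boolT | oboolT | psi | adt | gfun | unit | lit | boxLit | boxInj => exact .refl _
  | _ => simp only [Exp.subst]; constructor <;> solve_by_elim

-- Stated for an abstract relation `R` between substitutions, so that one induction serves both
-- renamings and pointwise parallel reduction; carrying the latter under a binder uses the former.
theorem Pared.subst_of_stable (hS : S.Closed)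
    (hR : ∀ {s s'}, R s s' → ∀ k, Pared S (s k) (s' k))
    (hup : ∀ {s s'}, R s s' → R (up s) (up s')) {e e' : Exp} (h : Pared S e e') (hs : R s s') :
    Pared S (e.subst s) (e'.subst s') := by
  induction h generalizing s s' with
  | refl e => exact Pared.subst_refl_of_stable hR hup e hs
  | fn h => rw [(hS.fn h s').2]; exact .fn h
  | oadt h _ ih =>
    rw [Exp.subst_inst, (hS.obliv h s').2]
    exact .oadt h (ih hs)
  | beta _ _ ih₁ ih₂ => rw [Exp.subst_inst]; exact .beta (ih₁ (hup hs)) (ih₂ hs)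
  | letBeta _ _ ih₁ ih₂ => rw [Exp.subst_inst]; exact .letBeta (ih₁ hs) (ih₂ (hup hs))
  | iteLit _ _ ih₁ ih₂ => rw [Exp.subst_cond]; exact .iteLit (ih₁ hs) (ih₂ hs)
  | muxBox _ _ ih₁ ih₂ => rw [Exp.subst_cond]; exact .muxBox (ih₁ hs) (ih₂ hs)
  | casesCtor _ _ ih₁ ih₂ =>
    rw [Exp.subst_inst]
    exact .casesCtor (es' := fun j => Exp.subst _ _) (ih₁ hs) fun j => ih₂ j (hup hs)
  | projPair _ _ ih₁ ih₂ => rw [Exp.subst_cond]; exact .projPair (ih₁ hs) (ih₂ hs)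
  | projPsiPair _ _ ih₁ ih₂ => rw [Exp.subst_cond]; exact .projPsiPair (ih₁ hs) (ih₂ hs)
  | secLit => exact .secLit
  | oinjBox => simp only [Exp.subst, OTy.subst_toExp, OVal.subst_toExp]; exact .oinjBox
  | omatchBox h₁ h₂ _ _ ih₁ ih₂ =>
    simp only [Exp.subst, Exp.subst_cond, Exp.subst_inst, OVal.subst_toExp]
    exact .omatchBox h₁ h₂ (ih₁ (hup hs)) (ih₂ (hup hs))
  | _ => simp only [Exp.subst]; constructor <;> solve_by_elim

theorem Pared.rename (hS : S.Closed) {e e' : Exp} (h : Pared S e e') (r : ℕ → ℕ) :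
    Pared S (e.rename r) (e'.rename r) := by
  simp only [Exp.rename_eq_subst]
  refine h.subst_of_stable hS (R := fun s s' => s = s') ?_ (congrArg up) rfl
  rintro s _ rfl k
  exact .refl _

theorem Pared.up (hS : S.Closed) (h : ∀ k, Pared S (s k) (s' k)) :
    ∀ k, Pared S (up s k) (up s' k)
  | 0 => .refl _
  | k + 1 => (h k).rename hS _

theorem Pared.subst (hS : S.Closed) {e e' : Exp} (h : Pared S e e')
    (hs : ∀ k, Pared S (s k) (s' k)) : Pared S (e.subst s) (e'.subst s') :=
  h.subst_of_stable hS (R := fun s s' => ∀ k, Pared S (s k) (s' k)) id (Pared.up hS) hs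

end Subst

theorem Pared.inst (hS : S.Closed) {e e' a a' : Exp} (h : Pared S e e') (ha : Pared S a a') :
    Pared S (e.inst a) (e'.inst a') :=
  h.subst hS fun
    | 0 => ha
    | _ + 1 => .refl _

/-! ### Confluence of parallel reduction -/

/-- The one-level congruence closure of `R`: both expressions have the same head, and their
immediate subexpressions are related by `R`.  In particular `Congr (fun x _ => P x) e e` says that
every immediate subexpression of `e` satisfies `P`. -/
inductive Congr (R : Exp → Exp → Prop) : Exp → Exp → Prop
  | unitT : Congr R .unitT .unitT
  | boolT : Congr R .boolT .boolT
  | oboolT : Congr R .oboolT .oboolT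
  | prod {t₁ t₁' t₂ t₂' : Exp} : R t₁ t₁' → R t₂ t₂' → Congr R (.prod t₁ t₂) (.prod t₁' t₂')
  | osum {t₁ t₁' t₂ t₂' : Exp} : R t₁ t₁' → R t₂ t₂' → Congr R (.osum t₁ t₂) (.osum t₁' t₂')
  | pi {t₁ t₁' t₂ t₂' : Exp} : R t₁ t₁' → R t₂ t₂' → Congr R (.pi t₁ t₂) (.pi t₁' t₂')
  | psi (T : Name) : Congr R (.psi T) (.psi T)
  | adt (T : Name) : Congr R (.adt T) (.adt T)
  | var (k : ℕ) : Congr R (.var k) (.var k)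
  | gfun (x : Name) : Congr R (.gfun x) (.gfun x)
  | unit : Congr R .unit .unit
  | lit (b : Bool) : Congr R (.lit b) (.lit b)
  | lam {t t' e e' : Exp} : R t t' → R e e' → Congr R (.lam t e) (.lam t' e')
  | letE {e₁ e₁' e₂ e₂' : Exp} : R e₁ e₁' → R e₂ e₂' → Congr R (.letE e₁ e₂) (.letE e₁' e₂')
  | app {e₁ e₁' e₂ e₂' : Exp} : R e₁ e₁' → R e₂ e₂' → Congr R (.app e₁ e₂) (.app e₁' e₂')
  | ctor {C : CName} {e e' : Exp} : R e e' → Congr R (.ctor C e) (.ctor C e')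
  | oapp {T : Name} {e e' : Exp} : R e e' → Congr R (.oapp T e) (.oapp T e')
  | ite {e₀ e₀' e₁ e₁' e₂ e₂' : Exp} :
      R e₀ e₀' → R e₁ e₁' → R e₂ e₂' → Congr R (.ite e₀ e₁ e₂) (.ite e₀' e₁' e₂')
  | mux {e₀ e₀' e₁ e₁' e₂ e₂' : Exp} :
      R e₀ e₀' → R e₁ e₁' → R e₂ e₂' → Congr R (.mux e₀ e₁ e₂) (.mux e₀' e₁' e₂')
  | pair {e₁ e₁' e₂ e₂' : Exp} : R e₁ e₁' → R e₂ e₂' → Congr R (.pair e₁ e₂) (.pair e₁' e₂')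
  | psiPair {e₁ e₁' e₂ e₂' : Exp} :
      R e₁ e₁' → R e₂ e₂' → Congr R (.psiPair e₁ e₂) (.psiPair e₁' e₂')
  | proj {b : Bool} {e e' : Exp} : R e e' → Congr R (.proj b e) (.proj b e')
  | oinj {b : Bool} {t t' e e' : Exp} : R t t' → R e e' → Congr R (.oinj b t e) (.oinj b t' e')
  | omatch {e₀ e₀' e₁ e₁' e₂ e₂' : Exp} :
      R e₀ e₀' → R e₁ e₁' → R e₂ e₂' → Congr R (.omatch e₀ e₁ e₂) (.omatch e₀' e₁' e₂')
  | cases {n : ℕ} {C : Fin n ↪ CName} {e₀ e₀' : Exp} {es es' : Fin n → Exp} :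
      R e₀ e₀' → (∀ i, R (es i) (es' i)) → Congr R (.cases n C e₀ es) (.cases n C e₀' es')
  | sec {e e' : Exp} : R e e' → Congr R (.sec e) (.sec e')
  | boxLit (b : Bool) : Congr R (.boxLit b) (.boxLit b)
  | boxInj (b : Bool) (w : OTy) (u : OVal) : Congr R (.boxInj b w u) (.boxInj b w u)

theorem Congr.refl {R : Exp → Exp → Prop} (hR : ∀ e, R e e) (e : Exp) : Congr R e e := by
  cases e <;> constructor <;> intros <;> apply hR

theorem Exp.induction_congr {P : Exp → Prop} (h : ∀ e, Congr (fun x _ => P x) e e → P e)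
    (e : Exp) : P e := by
  induction e <;> apply h <;> constructor <;> assumption

/-- Parallel contraction of an expression whose head is a redex; the subexpressions that survive
take part through `Pared`.  The shape of a redex is imposed by equations where constructor
patterns could not be inverted. -/
inductive Contract (S : GCtx) : Exp → Exp → Prop
  | fn {x : Name} {t e : Exp} : S x = some (.fn t e) → Contract S (.gfun x) e
  | oadt {T : Name} {t t' e e' : Exp} :
      S T = some (.obliv t t') → Pared S e e' → Contract S (.oapp T e) (t'.inst e')
  | beta {t e₁ e₁' e₂ e₂' : Exp} :
      Pared S e₁ e₁' → Pared S e₂ e₂' → Contract S (.app (.lam t e₁) e₂) (e₁'.inst e₂')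
  | letBeta {e₁ e₁' e₂ e₂' : Exp} :
      Pared S e₁ e₁' → Pared S e₂ e₂' → Contract S (.letE e₁ e₂) (e₂'.inst e₁')
  | iteLit {b : Bool} {e₁ e₁' e₂ e₂' : Exp} :
      Pared S e₁ e₁' → Pared S e₂ e₂' → Contract S (.ite (.lit b) e₁ e₂) (cond b e₁' e₂')
  | muxBox {b : Bool} {e₁ e₁' e₂ e₂' : Exp} :
      Pared S e₁ e₁' → Pared S e₂ e₂' → Contract S (.mux (.boxLit b) e₁ e₂) (cond b e₁' e₂')
  | casesCtor {n : ℕ} {C : Fin n ↪ CName} {i : Fin n} {e₀ e e' : Exp} {es es' : Fin n → Exp} :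
      e₀ = .ctor (C i) e → Pared S e e' → (∀ j, Pared S (es j) (es' j)) →
      Contract S (.cases n C e₀ es) ((es' i).inst e')
  | projPair {b : Bool} {e₁ e₁' e₂ e₂' : Exp} :
      Pared S e₁ e₁' → Pared S e₂ e₂' → Contract S (.proj b (.pair e₁ e₂)) (cond b e₁' e₂')
  | projPsiPair {b : Bool} {e₁ e₁' e₂ e₂' : Exp} :
      Pared S e₁ e₁' → Pared S e₂ e₂' → Contract S (.proj b (.psiPair e₁ e₂)) (cond b e₁' e₂')
  | secLit {b : Bool} : Contract S (.sec (.lit b)) (.boxLit b)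
  | oinjBox {b : Bool} {w : OTy} {u : OVal} {t e : Exp} :
      t = w.toExp → e = u.toExp → Contract S (.oinj b t e) (.boxInj b w u)
  | omatchBox {b : Bool} {w₁ w₂ : OTy} {u u₁ u₂ : OVal} {e₁ e₁' e₂ e₂' : Exp} :
      OValTy u₁ w₁ → OValTy u₂ w₂ → Pared S e₁ e₁' → Pared S e₂ e₂' →
      Contract S (.omatch (.boxInj b (.osum w₁ w₂) u) e₁ e₂)
        (.mux (.boxLit b)
          (cond b (e₁'.inst u.toExp) (e₁'.inst u₁.toExp))
          (cond b (e₂'.inst u₂.toExp) (e₂'.inst u.toExp)))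

theorem Pared.congr_or_contract {e e' : Exp} (h : Pared S e e') :
    Congr (Pared S) e e' ∨ Contract S e e' := by
  cases h with
  | refl => exact .inl (.refl .refl _)
  | fn | oadt | beta | letBeta | iteLit | muxBox | projPair | projPsiPair | secLit | omatchBox =>
    right; constructor <;> assumption
  | casesCtor h hs => exact .inr (.casesCtor rfl h hs)
  | oinjBox => exact .inr (.oinjBox rfl rfl)
  | _ => left; constructor <;> assumption

theorem Pared.eq_of_oty {w : OTy} {e : Exp} (h : Pared S w.toExp e) : e = w.toExp := by
  induction w generalizing e with
  | unit | obool => cases h; rfl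
  | prod w₁ w₂ ih₁ ih₂ =>
    match e, h.congr_or_contract with
    | _, .inl (.prod h₁ h₂) => rw [ih₁ h₁, ih₂ h₂, OTy.toExp]
  | osum w₁ w₂ ih₁ ih₂ =>
    match e, h.congr_or_contract with
    | _, .inl (.osum h₁ h₂) => rw [ih₁ h₁, ih₂ h₂, OTy.toExp]

theorem Pared.eq_of_oval {u : OVal} {e : Exp} (h : Pared S u.toExp e) : e = u.toExp := by
  induction u generalizing e with
  | unit | boxLit | boxInj => cases h; rfl
  | pair u₁ u₂ ih₁ ih₂ =>
    match e, h.congr_or_contract with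
    | _, .inl (.pair h₁ h₂) => rw [ih₁ h₁, ih₂ h₂, OVal.toExp]

/-- Two expressions are joinable if they have a common parallel reduct. -/
def Joins (S : GCtx) (a b : Exp) : Prop := ∃ c, Pared S a c ∧ Pared S b c

theorem Joins.of_pared {a b : Exp} (h : Pared S a b) : Joins S b a :=
  ⟨b, .refl b, h⟩

theorem Joins.symm {a b : Exp} : Joins S a b → Joins S b a
  | ⟨c, ha, hb⟩ => ⟨c, hb, ha⟩

theorem Joins.map {f : Exp → Exp} (hf : ∀ {x x'}, Pared S x x' → Pared S (f x) (f x'))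
    {a b : Exp} : Joins S a b → Joins S (f a) (f b)
  | ⟨_, ha, hb⟩ => ⟨_, hf ha, hf hb⟩

theorem Joins.map₂ {f : Exp → Exp → Exp}
    (hf : ∀ {x x' y y'}, Pared S x x' → Pared S y y' → Pared S (f x y) (f x' y'))
    {a b c d : Exp} : Joins S a b → Joins S c d → Joins S (f a c) (f b d)
  | ⟨_, ha, hb⟩, ⟨_, hc, hd⟩ => ⟨_, hf ha hc, hf hb hd⟩

theorem Joins.map₃ {f : Exp → Exp → Exp → Exp}
    (hf : ∀ {x x' y y' z z'}, Pared S x x' → Pared S y y' → Pared S z z' →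
      Pared S (f x y z) (f x' y' z'))
    {a b c d e e' : Exp} : Joins S a b → Joins S c d → Joins S e e' →
      Joins S (f a c e) (f b d e')
  | ⟨_, ha, hb⟩, ⟨_, hc, hd⟩, ⟨_, he, he'⟩ => ⟨_, hf ha hc he, hf hb hd he'⟩

theorem Joins.inst (hS : S.Closed) {a b c d : Exp} (h : Joins S a b) (h' : Joins S c d) :
    Joins S (a.inst c) (b.inst d) :=
  h.map₂ (.inst hS) h'

theorem Joins.cond {a b c d : Exp} (h : Joins S a b) (h' : Joins S c d) (i : Bool) :
    Joins S (cond i a c) (cond i b d) :=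
  h.map₂ (fun h h' => h.cond h' i) h'

theorem Congr.joins {a b : Exp} (h : Congr (Joins S) a b) : Joins S a b := by
  cases h with
  | prod h₁ h₂ => exact h₁.map₂ .prod h₂
  | osum h₁ h₂ => exact h₁.map₂ .osum h₂
  | pi h₁ h₂ => exact h₁.map₂ .pi h₂
  | lam h₁ h₂ => exact h₁.map₂ .lam h₂
  | letE h₁ h₂ => exact h₁.map₂ .letE h₂
  | app h₁ h₂ => exact h₁.map₂ .app h₂
  | ctor h => exact h.map .ctor
  | oapp h => exact h.map .oapp
  | ite h₀ h₁ h₂ => exact h₀.map₃ .ite h₁ h₂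
  | mux h₀ h₁ h₂ => exact h₀.map₃ .mux h₁ h₂
  | pair h₁ h₂ => exact h₁.map₂ .pair h₂
  | psiPair h₁ h₂ => exact h₁.map₂ .psiPair h₂
  | proj h => exact h.map .proj
  | oinj h₁ h₂ => exact h₁.map₂ .oinj h₂
  | omatch h₀ h₁ h₂ => exact h₀.map₃ .omatch h₁ h₂
  | cases h hs =>
    obtain ⟨_, ha, hb⟩ := h
    choose _ hsa hsb using hs
    exact ⟨_, .cases ha hsa, .cases hb hsb⟩
  | sec h => exact h.map .sec
  | _ => exact .of_pared (.refl _)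

/-- The diamond property at `e`: any two parallel reducts of `e` are joinable. -/
def Diamond (S : GCtx) (e : Exp) : Prop :=
  ∀ ⦃a b : Exp⦄, Pared S e a → Pared S e b → Joins S a b

theorem Congr.joins_of_diamond {e a b : Exp} (he : Congr (fun x _ => Diamond S x) e e)
    (ha : Congr (Pared S) e a) (hb : Congr (Pared S) e b) : Congr (Joins S) a b := by
  unfold Diamond at he
  cases he <;> cases ha <;> cases hb <;> constructor <;> solve_by_elim

theorem Diamond.intro {e : Exp} (he : Congr (fun x _ => Diamond S x) e e)
    (h : ∀ a b, Contract S e a → Congr (Pared S) e b → Joins S a b)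
    (h' : ∀ a b, Contract S e a → Contract S e b → Joins S a b) : Diamond S e := by
  intro a b ha hb
  obtain ha | ha := ha.congr_or_contract <;> obtain hb | hb := hb.congr_or_contract
  · exact (he.joins_of_diamond ha hb).joins
  · exact (h b a hb ha).symm
  · exact h a b ha hb
  · exact h' a b ha hb

theorem Diamond.lam_inv {t e a b : Exp} (h : Diamond S (.lam t e)) (ha : Pared S e a)
    (hb : Pared S e b) : Joins S a b :=
  match h (.lam (.refl t) ha) (.lam (.refl t) hb) with
  | ⟨_, ha, hb⟩ => match ha.congr_or_contract, hb.congr_or_contract with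
    | .inl (.lam _ ha), .inl (.lam _ hb) => ⟨_, ha, hb⟩

theorem Diamond.ctor_inv {C : CName} {e a b : Exp} (h : Diamond S (.ctor C e))
    (ha : Pared S e a) (hb : Pared S e b) : Joins S a b :=
  match h (.ctor ha) (.ctor hb) with
  | ⟨_, ha, hb⟩ => match ha.congr_or_contract, hb.congr_or_contract with
    | .inl (.ctor ha), .inl (.ctor hb) => ⟨_, ha, hb⟩

theorem Diamond.pair_inv {e₁ e₂ a₁ a₂ b₁ b₂ : Exp} (h : Diamond S (.pair e₁ e₂))
    (ha₁ : Pared S e₁ a₁) (ha₂ : Pared S e₂ a₂) (hb₁ : Pared S e₁ b₁) (hb₂ : Pared S e₂ b₂) :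
    Joins S a₁ b₁ ∧ Joins S a₂ b₂ :=
  match h (.pair ha₁ ha₂) (.pair hb₁ hb₂) with
  | ⟨_, ha, hb⟩ => match ha.congr_or_contract, hb.congr_or_contract with
    | .inl (.pair ha₁ ha₂), .inl (.pair hb₁ hb₂) => ⟨⟨_, ha₁, hb₁⟩, ⟨_, ha₂, hb₂⟩⟩

theorem Diamond.psiPair_inv {e₁ e₂ a₁ a₂ b₁ b₂ : Exp} (h : Diamond S (.psiPair e₁ e₂))
    (ha₁ : Pared S e₁ a₁) (ha₂ : Pared S e₂ a₂) (hb₁ : Pared S e₁ b₁) (hb₂ : Pared S e₂ b₂) :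
    Joins S a₁ b₁ ∧ Joins S a₂ b₂ :=
  match h (.psiPair ha₁ ha₂) (.psiPair hb₁ hb₂) with
  | ⟨_, ha, hb⟩ => match ha.congr_or_contract, hb.congr_or_contract with
    | .inl (.psiPair ha₁ ha₂), .inl (.psiPair hb₁ hb₂) => ⟨⟨_, ha₁, hb₁⟩, ⟨_, ha₂, hb₂⟩⟩

theorem Diamond.gfun {x : Name} : Diamond S (.gfun x) := by
  refine .intro (.gfun x) ?_ ?_
  · rintro _ _ ⟨hx⟩ ⟨⟩
    exact .of_pared (.fn hx)
  · rintro _ _ ⟨hx⟩ ⟨hx'⟩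
    cases hx.symm.trans hx'
    exact .of_pared (.refl _)

theorem Diamond.oapp (hS : S.Closed) {T : Name} {e : Exp} (h : Diamond S e) :
    Diamond S (.oapp T e) := by
  refine .intro (.oapp h) ?_ ?_
  · intro a b ha hb
    cases ha with | oadt hT ha =>
    cases hb with | oapp hb =>
    obtain ⟨_, ha, hb⟩ := h ha hb
    exact ⟨_, .inst hS (.refl _) ha, .oadt hT hb⟩
  · intro a b ha hb
    cases ha with | oadt hT ha =>
    cases hb with | oadt hT' hb =>
    cases hT.symm.trans hT'
    exact (Joins.of_pared (.refl _)).inst hS (h ha hb)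

theorem Diamond.app (hS : S.Closed) {e₁ e₂ : Exp} (h₁ : Diamond S e₁) (h₂ : Diamond S e₂) :
    Diamond S (.app e₁ e₂) := by
  refine .intro (.app h₁ h₂) ?_ ?_
  · intro a b ha hb
    cases ha with | beta ha₁ ha₂ =>
    cases hb with | app hb₁ hb₂ =>
    obtain ⟨c₂, ha₂, hb₂⟩ := h₂ ha₂ hb₂
    match hb₁.congr_or_contract with
    | .inl (.lam _ hb₁) =>
      obtain ⟨c₁, ha₁, hb₁⟩ := h₁.lam_inv ha₁ hb₁
      exact ⟨_, ha₁.inst hS ha₂, .beta hb₁ hb₂⟩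
  · intro a b ha hb
    cases ha with | beta ha₁ ha₂ =>
    cases hb with | beta hb₁ hb₂ =>
    exact (h₁.lam_inv ha₁ hb₁).inst hS (h₂ ha₂ hb₂)

theorem Diamond.letE (hS : S.Closed) {e₁ e₂ : Exp} (h₁ : Diamond S e₁) (h₂ : Diamond S e₂) :
    Diamond S (.letE e₁ e₂) := by
  refine .intro (.letE h₁ h₂) ?_ ?_
  · intro a b ha hb
    cases ha with | letBeta ha₁ ha₂ =>
    cases hb with | letE hb₁ hb₂ =>
    obtain ⟨c₁, ha₁, hb₁⟩ := h₁ ha₁ hb₁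
    obtain ⟨c₂, ha₂, hb₂⟩ := h₂ ha₂ hb₂
    exact ⟨_, ha₂.inst hS ha₁, .letBeta hb₁ hb₂⟩
  · intro a b ha hb
    cases ha with | letBeta ha₁ ha₂ =>
    cases hb with | letBeta hb₁ hb₂ =>
    exact (h₂ ha₂ hb₂).inst hS (h₁ ha₁ hb₁)

theorem Diamond.ite {e₀ e₁ e₂ : Exp} (h₀ : Diamond S e₀) (h₁ : Diamond S e₁)
    (h₂ : Diamond S e₂) : Diamond S (.ite e₀ e₁ e₂) := by
  refine .intro (.ite h₀ h₁ h₂) ?_ ?_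
  · intro a b ha hb
    cases ha with | iteLit ha₁ ha₂ =>
    cases hb with | ite hb₀ hb₁ hb₂ =>
    cases hb₀
    obtain ⟨c₁, ha₁, hb₁⟩ := h₁ ha₁ hb₁
    obtain ⟨c₂, ha₂, hb₂⟩ := h₂ ha₂ hb₂
    exact ⟨_, ha₁.cond ha₂ _, .iteLit hb₁ hb₂⟩
  · intro a b ha hb
    cases ha with | iteLit ha₁ ha₂ =>
    cases hb with | iteLit hb₁ hb₂ =>
    exact (h₁ ha₁ hb₁).cond (h₂ ha₂ hb₂) _

theorem Diamond.mux {e₀ e₁ e₂ : Exp} (h₀ : Diamond S e₀) (h₁ : Diamond S e₁)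
    (h₂ : Diamond S e₂) : Diamond S (.mux e₀ e₁ e₂) := by
  refine .intro (.mux h₀ h₁ h₂) ?_ ?_
  · intro a b ha hb
    cases ha with | muxBox ha₁ ha₂ =>
    cases hb with | mux hb₀ hb₁ hb₂ =>
    cases hb₀
    obtain ⟨c₁, ha₁, hb₁⟩ := h₁ ha₁ hb₁
    obtain ⟨c₂, ha₂, hb₂⟩ := h₂ ha₂ hb₂
    exact ⟨_, ha₁.cond ha₂ _, .muxBox hb₁ hb₂⟩
  · intro a b ha hb
    cases ha with | muxBox ha₁ ha₂ =>
    cases hb with | muxBox hb₁ hb₂ =>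
    exact (h₁ ha₁ hb₁).cond (h₂ ha₂ hb₂) _

theorem Diamond.proj {i : Bool} {e : Exp} (h : Diamond S e) : Diamond S (.proj i e) := by
  refine .intro (.proj h) ?_ ?_
  · intro a b ha hb
    cases hb with | proj hb =>
    cases ha with
    | projPair ha₁ ha₂ =>
      match hb.congr_or_contract with
      | .inl (.pair hb₁ hb₂) =>
        obtain ⟨⟨c₁, ha₁, hb₁⟩, c₂, ha₂, hb₂⟩ := h.pair_inv ha₁ ha₂ hb₁ hb₂
        exact ⟨_, ha₁.cond ha₂ _, .projPair hb₁ hb₂⟩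
    | projPsiPair ha₁ ha₂ =>
      match hb.congr_or_contract with
      | .inl (.psiPair hb₁ hb₂) =>
        obtain ⟨⟨c₁, ha₁, hb₁⟩, c₂, ha₂, hb₂⟩ := h.psiPair_inv ha₁ ha₂ hb₁ hb₂
        exact ⟨_, ha₁.cond ha₂ _, .projPsiPair hb₁ hb₂⟩
  · intro a b ha hb
    cases ha with
    | projPair ha₁ ha₂ =>
      cases hb with | projPair hb₁ hb₂ =>
      obtain ⟨h₁, h₂⟩ := h.pair_inv ha₁ ha₂ hb₁ hb₂
      exact h₁.cond h₂ _
    | projPsiPair ha₁ ha₂ =>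
      cases hb with | projPsiPair hb₁ hb₂ =>
      obtain ⟨h₁, h₂⟩ := h.psiPair_inv ha₁ ha₂ hb₁ hb₂
      exact h₁.cond h₂ _

theorem Diamond.oinj {i : Bool} {t e : Exp} (h₁ : Diamond S t) (h₂ : Diamond S e) :
    Diamond S (.oinj i t e) := by
  refine .intro (.oinj h₁ h₂) ?_ ?_
  · intro a b ha hb
    cases ha with | oinjBox hw hu =>
    cases hb with | oinj hb₁ hb₂ =>
    subst hw hu
    rw [hb₁.eq_of_oty, hb₂.eq_of_oval]
    exact .of_pared .oinjBox
  · intro a b ha hb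
    cases ha with | oinjBox hw hu =>
    cases hb with | oinjBox hw' hu' =>
    rw [OTy.toExp_injective (hw.symm.trans hw'), OVal.toExp_injective (hu.symm.trans hu')]
    exact .of_pared (.refl _)

-- Two contractions of the same `omatch` may pick different inhabitants for the branch not taken.
-- Their reducts are joined by contracting the resulting `mux`, which discards that branch.
theorem Diamond.omatch (hS : S.Closed) {e₀ e₁ e₂ : Exp} (h₀ : Diamond S e₀)
    (h₁ : Diamond S e₁) (h₂ : Diamond S e₂) : Diamond S (.omatch e₀ e₁ e₂) := by
  have inst_oval {a b : Exp} (h : Joins S a b) (u : OVal) :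
      Joins S (a.inst u.toExp) (b.inst u.toExp) := h.inst hS (.of_pared (.refl _))
  refine .intro (.omatch h₀ h₁ h₂) ?_ ?_
  · intro a b ha hb
    cases ha with | omatchBox hu₁ hu₂ ha₁ ha₂ =>
    cases hb with | omatch hb₀ hb₁ hb₂ =>
    cases hb₀
    obtain ⟨c₁, ha₁, hb₁⟩ := h₁ ha₁ hb₁
    obtain ⟨c₂, ha₂, hb₂⟩ := h₂ ha₂ hb₂
    exact ⟨_, .mux (.refl _)
      (.cond (ha₁.inst hS (.refl _)) (ha₁.inst hS (.refl _)) _)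
      (.cond (ha₂.inst hS (.refl _)) (ha₂.inst hS (.refl _)) _), .omatchBox hu₁ hu₂ hb₁ hb₂⟩
  · intro a b ha hb
    cases ha with | @omatchBox i _ _ u _ _ _ _ _ _ _ _ ha₁ ha₂ =>
    cases hb with | omatchBox _ _ hb₁ hb₂ =>
    cases i
    · obtain ⟨c, ha, hb⟩ := inst_oval (h₂ ha₂ hb₂) u
      exact ⟨c, .muxBox (b := false) (.refl _) ha, .muxBox (b := false) (.refl _) hb⟩
    · obtain ⟨c, ha, hb⟩ := inst_oval (h₁ ha₁ hb₁) u
      exact ⟨c, .muxBox (b := true) ha (.refl _), .muxBox (b := true) hb (.refl _)⟩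

theorem Diamond.cases (hS : S.Closed) {n : ℕ} {C : Fin n ↪ CName} {e₀ : Exp}
    {es : Fin n → Exp} (h₀ : Diamond S e₀) (h : ∀ i, Diamond S (es i)) :
    Diamond S (.cases n C e₀ es) := by
  refine .intro (.cases h₀ h) ?_ ?_
  · intro a b ha hb
    cases ha with | @casesCtor _ _ i _ _ _ _ _ he ha₀ ha =>
    cases hb with | cases hb₀ hb =>
    subst he
    match hb₀.congr_or_contract with
    | .inl (.ctor hb₀) =>
      obtain ⟨c₀, ha₀, hb₀⟩ := h₀.ctor_inv ha₀ hb₀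
      choose cs ha hb using fun j => h j (ha j) (hb j)
      exact ⟨_, (ha i).inst hS ha₀, .casesCtor hb₀ hb⟩
  · intro a b ha hb
    cases ha with | casesCtor he ha₀ ha =>
    cases hb with | casesCtor he' hb₀ hb =>
    subst he
    injection he' with hC he
    obtain rfl := C.injective hC
    subst he
    exact (h _ (ha _) (hb _)).inst hS (h₀.ctor_inv ha₀ hb₀)

theorem Diamond.sec {e : Exp} (h : Diamond S e) : Diamond S (.sec e) := by
  refine .intro (.sec h) ?_ ?_
  · rintro _ _ ⟨⟩ hb
    cases hb with | sec hb =>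
    cases hb
    exact .of_pared .secLit
  · rintro _ _ ⟨⟩ ⟨⟩
    exact .of_pared (.refl _)

theorem Pared.diamond (hS : S.Closed) (e : Exp) : Diamond S e := by
  induction e using Exp.induction_congr with | h e he =>
  cases he with
  | gfun => exact .gfun
  | oapp h => exact .oapp hS h
  | app h₁ h₂ => exact .app hS h₁ h₂
  | letE h₁ h₂ => exact .letE hS h₁ h₂
  | ite h₀ h₁ h₂ => exact .ite h₀ h₁ h₂
  | mux h₀ h₁ h₂ => exact .mux h₀ h₁ h₂
  | proj h => exact .proj h
  | oinj h₁ h₂ => exact .oinj h₁ h₂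
  | omatch h₀ h₁ h₂ => exact .omatch hS h₀ h₁ h₂
  | cases h₀ h => exact .cases hS h₀ h
  | sec h => exact .sec h
  | _ => exact .intro (by constructor <;> assumption) nofun nofun

/-! ### Type equivalence -/

/-- Iterated parallel reduction. -/
abbrev Pareds (S : GCtx) : Exp → Exp → Prop := Relation.ReflTransGen (Pared S)

theorem TyEquiv.refl (a : Exp) : TyEquiv S a a := Relation.EqvGen.refl a

theorem TyEquiv.symm {a b : Exp} (h : TyEquiv S a b) : TyEquiv S b a :=
  Relation.EqvGen.symm _ _ h

theorem TyEquiv.trans {a b c : Exp} (h : TyEquiv S a b) (h' : TyEquiv S b c) : TyEquiv S a c :=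
  Relation.EqvGen.trans _ _ _ h h'

theorem Pared.tyEquiv {a b : Exp} (h : Pared S a b) : TyEquiv S a b := Relation.EqvGen.rel _ _ h

theorem TyEquiv.map {f : Exp → Exp} (hf : ∀ {x y}, Pared S x y → Pared S (f x) (f y))
    {a b : Exp} (h : TyEquiv S a b) : TyEquiv S (f a) (f b) := by
  induction h with
  | rel _ _ h => exact (hf h).tyEquiv
  | refl => exact .refl _
  | symm _ _ _ ih => exact ih.symm
  | trans _ _ _ _ _ ih₁ ih₂ => exact ih₁.trans ih₂

theorem TyEquiv.subst (hS : S.Closed) {a b : Exp} (h : TyEquiv S a b) (s : ℕ → Exp) :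
    TyEquiv S (a.subst s) (b.subst s) :=
  h.map fun h => h.subst hS fun _ => .refl _

theorem TyEquiv.inst (hS : S.Closed) {a b c d : Exp} (h : TyEquiv S a b) (h' : TyEquiv S c d) :
    TyEquiv S (a.inst c) (b.inst d) :=
  (h.map (f := fun x => x.inst c) fun h => h.inst hS (.refl _)).trans
    (h'.map fun h => .inst hS (.refl _) h)

theorem TyEquiv.join (hS : S.Closed) {a b : Exp} (h : TyEquiv S a b) :
    Relation.Join (Pareds S) a b := by
  have hequiv : Equivalence (Relation.Join (Pareds S)) :=
    Relation.equivalence_join_reflTransGen fun a b c hb hc =>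
      let ⟨d, h₁, h₂⟩ := Pared.diamond hS a hb hc
      ⟨d, .single h₁, .single h₂⟩
  exact hequiv.eqvGen_iff.1 (h.mono fun _ _ h => ⟨_, .single h, .refl⟩)

/-- The heads of types that no reduction rule contracts: every head of a type except oblivious
type application and the `let`, `if` and `match` of types. -/
inductive TyFormer : Exp → Prop
  | unitT : TyFormer .unitT
  | boolT : TyFormer .boolT
  | oboolT : TyFormer .oboolT
  | prod (t₁ t₂ : Exp) : TyFormer (.prod t₁ t₂)
  | osum (t₁ t₂ : Exp) : TyFormer (.osum t₁ t₂)
  | pi (t₁ t₂ : Exp) : TyFormer (.pi t₁ t₂)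
  | psi (T : Name) : TyFormer (.psi T)
  | adt (T : Name) : TyFormer (.adt T)

theorem OTy.tyFormer_toExp (w : OTy) : TyFormer w.toExp := by
  cases w <;> constructor

theorem Congr.imp {R R' : Exp → Exp → Prop} (hR : ∀ {x y}, R x y → R' x y) {a b : Exp}
    (h : Congr R a b) : Congr R' a b := by
  cases h <;> constructor <;> intros <;> apply hR <;> solve_by_elim

theorem Congr.symm {R : Exp → Exp → Prop} (hR : ∀ {x y}, R x y → R y x) {a b : Exp}
    (h : Congr R a b) : Congr R b a := by
  cases h <;> constructor <;> intros <;> apply hR <;> solve_by_elim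

theorem Congr.trans {R : Exp → Exp → Prop} (hR : ∀ {x y z}, R x y → R y z → R x z) {a b c : Exp}
    (h : Congr R a b) (h' : Congr R b c) : Congr R a c := by
  cases h with
  | cases h₀ h =>
    cases h' with
    | cases h₀' h' => exact .cases (hR h₀ h₀') fun i => hR (h i) (h' i)
  | _ => cases h'; constructor <;> exact hR ‹_› ‹_›

theorem TyFormer.of_congr {R : Exp → Exp → Prop} {a b : Exp} (ha : TyFormer a)
    (h : Congr R a b) : TyFormer b := by
  cases ha <;> cases h <;> constructor

theorem TyFormer.congr_of_pared {a b : Exp} (ha : TyFormer a) (h : Pared S a b) :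
    Congr (Pared S) a b :=
  h.congr_or_contract.resolve_right fun hc => by cases ha <;> cases hc

theorem TyFormer.congr_of_pareds {a b : Exp} (ha : TyFormer a) (h : Pareds S a b) :
    Congr (TyEquiv S) a b := by
  induction h with
  | refl => exact .refl .refl a
  | tail _ h ih => exact ih.trans .trans (((ha.of_congr ih).congr_of_pared h).imp Pared.tyEquiv)

theorem TyEquiv.exists_pareds (hS : S.Closed) {a b : Exp} (h : TyEquiv S a b)
    (hb : TyFormer b) : ∃ b', Pareds S a b' ∧ Congr (TyEquiv S) b b' :=
  let ⟨b', h₁, h₂⟩ := h.join hS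
  ⟨b', h₁, hb.congr_of_pareds h₂⟩

theorem TyEquiv.congr (hS : S.Closed) {a b : Exp} (h : TyEquiv S a b) (ha : TyFormer a)
    (hb : TyFormer b) : Congr (TyEquiv S) a b :=
  let ⟨_, h₁, h₂⟩ := h.exists_pareds hS hb
  (ha.congr_of_pareds h₁).trans .trans (h₂.symm .symm)

theorem OTy.eq_of_tyEquiv (hS : S.Closed) {w w' : OTy} (h : TyEquiv S w.toExp w'.toExp) :
    w = w' := by
  induction w generalizing w' with
  | unit | obool =>
    cases w' <;> first | rfl | cases h.congr hS (tyFormer_toExp _) (tyFormer_toExp _)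
  | prod w₁ w₂ ih₁ ih₂ | osum w₁ w₂ ih₁ ih₂ =>
    cases w' <;> cases h.congr hS (tyFormer_toExp _) (tyFormer_toExp _)
    rename_i h₁ h₂
    rw [ih₁ h₁, ih₂ h₂]

/-! ### Renaming and substitution in judgments -/

/-- Substitution in the right-hand side of a judgment. -/
def Cls.subst (s : ℕ → Exp) : Cls → Cls
  | .ty t => .ty (t.subst s)
  | .kd k => .kd k

theorem Cls.subst_var (c : Cls) : c.subst .var = c := by
  cases c <;> simp [Cls.subst]

theorem Judg.subst_congr {G : Ctx} {e : Exp} {c : Cls} (h : Judg S G e c)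
    {s s' : ℕ → Exp} (hs : ∀ i < G.length, s i = s' i) : e.subst s = e.subst s' := by
  have hup : ∀ {G : Ctx} {s s' : ℕ → Exp} (t : Exp), (∀ i < G.length, s i = s' i) →
      ∀ i < (t :: G).length, up s i = up s' i := by
    rintro G s s' t hs (_ | i) hi
    · rfl
    · rw [up_succ, up_succ, hs i (by simpa using hi)]
  induction h generalizing s s' with
  | kSub _ _ ih => exact ih hs
  | tConv _ _ _ ih _ => exact ih hs
  | kUnit | kBool | kOBool | kADT | kPsi | tUnit | tLit | tFun | tBoxLit | tBoxInj => rfl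
  | kOADT _ _ ih | tProj _ ih | tCtor _ _ ih | tPsiProj₁ _ _ ih | tPsiProj₂ _ _ ih
  | tSec _ ih => simp only [Exp.subst, ih hs]
  | kPi _ _ ih₁ ih₂ | kLet _ _ ih₁ ih₂ | tLet _ _ ih₁ ih₂ | tAbs _ _ ih₂ ih₁ =>
    simp only [Exp.subst, ih₁ hs, ih₂ (hup _ hs)]
  | kProd _ _ ih₁ ih₂ | kOSum _ _ ih₁ ih₂ | tApp _ _ ih₁ ih₂ | tPair _ _ ih₁ ih₂
  | tPsiPair _ _ _ ih₁ ih₂ => simp only [Exp.subst, ih₁ hs, ih₂ hs]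
  | tOInj _ _ ih₁ ih₂ => exact congrArg₂ (Exp.oinj _) (ih₂ hs) (ih₁ hs)
  | kIf _ _ _ ih₀ ih₁ ih₂ | tIf _ _ _ _ ih₀ ih₁ ih₂ _ | tMux _ _ _ _ ih₀ _ ih₁ ih₂ =>
    simp only [Exp.subst, ih₀ hs, ih₁ hs, ih₂ hs]
  | tOMatch _ _ _ _ ih₀ _ ih₁ ih₂ =>
    simp only [Exp.subst, ih₀ hs, ih₁ (hup _ hs), ih₂ (hup _ hs)]
  | kMatch _ _ _ ih₀ ih | tMatch _ _ _ _ ih₀ ih _ =>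
    simp only [Exp.subst, ih₀ hs, fun i => ih i (hup _ hs)]
  | tVar h => exact hs _ (List.getElem?_eq_some_iff.1 h).1

theorem Judg.subst_nil {e : Exp} {c : Cls} (h : Judg S [] e c) (s : ℕ → Exp) : e.subst s = e :=
  (h.subst_congr (by simp)).trans e.subst_var

theorem GCtx.Ok.closed (hS : S.Ok) : S.Closed where
  fn h s := by
    cases hS _ _ h with
    | fn h₁ h₂ => exact ⟨h₁.subst_nil s, h₂.subst_nil s⟩
  data h i s := by
    cases hS _ _ h with
    | data h => exact (h i).subst_nil s
  obliv h s := by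
    cases hS _ _ h with
    | obliv h₁ h₂ =>
      refine ⟨h₁.subst_nil s, (h₂.subst_congr fun i hi => ?_).trans (Exp.subst_var _)⟩
      obtain rfl : i = 0 := by simpa using hi
      rfl

theorem Exp.rename_add_two (t : Exp) (k : ℕ) :
    t.rename (· + (k + 1 + 1)) = (t.rename (· + (k + 1))).shift := by
  rw [Exp.shift, Exp.rename_rename]
  rfl

/-- The substitution `s` maps the variables of `G` to expressions of the substituted types
in `G'`. -/
def SubstOk (S : GCtx) (G' : Ctx) (s : ℕ → Exp) (G : Ctx) : Prop :=
  ∀ ⦃i : ℕ⦄ ⦃t : Exp⦄, G[i]? = some t → HasType S G' (s i) ((t.rename (· + (i + 1))).subst s)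

theorem Judg.subst_of_stable (hS : S.Closed) {R : Ctx → (ℕ → Exp) → Ctx → Prop}
    (hR : ∀ {G' s G}, R G' s G → SubstOk S G' s G)
    (hup : ∀ {G' s G}, R G' s G → ∀ t, R (t.subst s :: G') (up s) (t :: G))
    {G G' : Ctx} {s : ℕ → Exp} {e : Exp} {c : Cls} (h : Judg S G e c) (hs : R G' s G) :
    Judg S G' (e.subst s) (c.subst s) := by
  induction h generalizing s G' with
  | kSub _ hk ih => exact .kSub (ih hs) hk
  | kUnit => exact .kUnit
  | kBool => exact .kBool
  | kOBool => exact .kOBool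
  | kADT h => exact .kADT h
  | kOADT h _ ih => exact .kOADT h ((hS.obliv h s).1 ▸ ih hs)
  | kPi _ _ ih₁ ih₂ => exact .kPi (ih₁ hs) (ih₂ (hup hs _))
  | kProd _ _ ih₁ ih₂ => exact .kProd (ih₁ hs) (ih₂ hs)
  | kOSum _ _ ih₁ ih₂ => exact .kOSum (ih₁ hs) (ih₂ hs)
  | kPsi h => exact .kPsi h
  | kLet _ _ ih₁ ih₂ => exact .kLet (ih₁ hs) (ih₂ (hup hs _))
  | kIf _ _ _ ih₀ ih₁ ih₂ => exact .kIf (ih₀ hs) (ih₁ hs) (ih₂ hs)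
  | kMatch h _ _ ih₀ ih => exact .kMatch h (ih₀ hs) fun i => hS.data h i s ▸ ih i (hup hs _)
  | tConv _ he _ ih₁ ih₂ => exact .tConv (ih₁ hs) (he.subst hS s) (ih₂ hs)
  | tUnit => exact .tUnit
  | tLit => exact .tLit
  | tVar h => exact hR hs h
  | tFun h =>
    rw [Cls.subst, (hS.fn h s).1]
    exact .tFun h
  | tAbs _ _ ih₁ ih₂ => exact .tAbs (ih₁ (hup hs _)) (ih₂ hs)
  | tApp _ _ ih₁ ih₂ =>
    rw [Cls.subst, Exp.subst_inst]
    exact .tApp (ih₁ hs) (ih₂ hs)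
  | tLet _ _ ih₁ ih₂ =>
    rw [Cls.subst, Exp.subst_inst]
    exact .tLet (ih₁ hs) (ih₂ (hup hs _))
  | tPair _ _ ih₁ ih₂ => exact .tPair (ih₁ hs) (ih₂ hs)
  | tProj _ ih =>
    rw [Cls.subst, Exp.subst_cond]
    exact .tProj (ih hs)
  | tIf _ _ _ _ ih₀ ih₁ ih₂ ih₃ =>
    simp only [Cls.subst, Exp.subst_inst] at ih₁ ih₂ ih₃ ⊢
    exact .tIf (ih₀ hs) (ih₁ hs) (ih₂ hs) (ih₃ hs)
  | tCtor h _ ih => exact .tCtor h (hS.data h _ s ▸ ih hs)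
  | tMatch h _ _ _ ih₀ ih₁ ih₂ =>
    simp only [Cls.subst, Exp.subst_inst] at ih₁ ih₂ ⊢
    refine .tMatch h (ih₀ hs) (fun i => ?_) (ih₂ hs)
    exact Exp.subst_instCtor _ _ s ▸ hS.data h i s ▸ ih₁ i (hup hs _)
  | tPsiPair h _ _ ih₁ ih₂ => exact .tPsiPair h ((hS.obliv h s).1 ▸ ih₁ hs) (ih₂ hs)
  | tPsiProj₁ h _ ih =>
    rw [Cls.subst, (hS.obliv h s).1]
    exact .tPsiProj₁ h (ih hs)
  | tPsiProj₂ h _ ih => exact .tPsiProj₂ h (ih hs)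
  | tMux _ _ _ _ ih₀ ih ih₁ ih₂ => exact .tMux (ih₀ hs) (ih hs) (ih₁ hs) (ih₂ hs)
  | tOInj _ _ ih₁ ih₂ => exact .tOInj (Exp.subst_cond _ _ _ s ▸ ih₁ hs) (ih₂ hs)
  | tOMatch _ _ _ _ ih₀ ih ih₁ ih₂ =>
    exact .tOMatch (ih₀ hs) (ih hs) (Exp.subst_shift _ s ▸ ih₁ (hup hs _))
      (Exp.subst_shift _ s ▸ ih₂ (hup hs _))
  | tSec _ ih => exact .tSec (ih hs)
  | tBoxLit => exact .tBoxLit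
  | tBoxInj h =>
    rw [Cls.subst, OTy.subst_toExp]
    exact .tBoxInj h

/-- The renaming `r` maps the variables of `G` to variables of `G'` of the same (renamed) type. -/
def RenOk (G' : Ctx) (r : ℕ → ℕ) (G : Ctx) : Prop :=
  ∀ ⦃i : ℕ⦄ ⦃t : Exp⦄, G[i]? = some t →
    ∃ t', G'[r i]? = some t' ∧ t'.rename (· + (r i + 1)) = (t.rename (· + (i + 1))).rename r

theorem RenOk.up {G' G : Ctx} {r : ℕ → ℕ} (h : RenOk G' r G) (t : Exp) :
    RenOk (t.rename r :: G') (upRen r) (t :: G)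
  | 0, _, rfl => ⟨_, rfl, (t.rename_shift r).symm⟩
  | i + 1, t₁, ht => by
    obtain ⟨t', h₁, h₂⟩ := h ht
    refine ⟨t', h₁, ?_⟩
    rw [upRen_succ, Exp.rename_add_two, h₂, Exp.rename_add_two, Exp.rename_shift]

theorem RenOk.substOk {G' G : Ctx} {r : ℕ → ℕ} (h : RenOk G' r G) :
    SubstOk S G' (Exp.var ∘ r) G := fun i t ht => by
  obtain ⟨t', h₁, h₂⟩ := h ht
  rw [← Exp.rename_eq_subst, ← h₂]
  exact .tVar h₁

theorem Judg.rename (hS : S.Closed) {G G' : Ctx} {e : Exp} {c : Cls} (h : Judg S G e c)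
    {r : ℕ → ℕ} (hr : RenOk G' r G) : Judg S G' (e.rename r) (c.subst (Exp.var ∘ r)) := by
  rw [Exp.rename_eq_subst]
  refine h.subst_of_stable hS (R := fun G' s G => ∃ r, s = Exp.var ∘ r ∧ RenOk G' r G) ?_ ?_
    ⟨r, rfl, hr⟩
  · rintro G' _ G ⟨r, rfl, hr⟩
    exact hr.substOk
  · rintro G' _ G ⟨r, rfl, hr⟩ t
    rw [up_var_comp, ← Exp.rename_eq_subst]
    exact ⟨_, rfl, hr.up t⟩

theorem Judg.shift_ty (hS : S.Closed) {G : Ctx} {e t : Exp} (h : HasType S G e t) (t₁ : Exp) :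
    HasType S (t₁ :: G) e.shift t.shift := by
  have hr := h.rename hS (r := (· + 1)) (G' := t₁ :: G) fun i t ht => ⟨t, ht, t.rename_add_two i⟩
  rwa [Cls.subst, ← Exp.rename_eq_subst] at hr

theorem Judg.shift_kd (hS : S.Closed) {G : Ctx} {e : Exp} {k : Kind} (h : HasKind S G e k)
    (t₁ : Exp) : HasKind S (t₁ :: G) e.shift k :=
  h.rename hS fun i t ht => ⟨t, ht, t.rename_add_two i⟩

theorem SubstOk.up (hS : S.Closed) {G' G : Ctx} {s : ℕ → Exp} (h : SubstOk S G' s G) (t : Exp) :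
    SubstOk S (t.subst s :: G') (up s) (t :: G)
  | 0, _, rfl => (t.subst_shift s).symm ▸ .tVar rfl
  | i + 1, t₁, ht => by
    rw [Exp.rename_add_two, Exp.subst_shift]
    exact (h ht).shift_ty hS _

theorem Judg.subst (hS : S.Closed) {G G' : Ctx} {e : Exp} {c : Cls} (h : Judg S G e c)
    {s : ℕ → Exp} (hs : SubstOk S G' s G) : Judg S G' (e.subst s) (c.subst s) :=
  h.subst_of_stable hS (R := SubstOk S) id (SubstOk.up hS) hs

theorem SubstOk.scons {G : Ctx} {a t : Exp} (h : HasType S G a t) :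
    SubstOk S G (scons a .var) (t :: G)
  | 0, _, rfl => by
    have ht := t.inst_shift a
    rw [Exp.inst] at ht
    exact ht.symm ▸ h
  | i + 1, t₁, ht => by
    have ht₁ := (t₁.rename (· + (i + 1))).inst_shift a
    rw [Exp.inst] at ht₁
    rw [Exp.rename_add_two, ht₁]
    exact .tVar ht

theorem Judg.inst_ty (hS : S.Closed) {G : Ctx} {a e t t' : Exp} (h : HasType S (t :: G) e t')
    (ha : HasType S G a t) : HasType S G (e.inst a) (t'.inst a) :=
  h.subst hS (.scons ha)

theorem Judg.inst_kd (hS : S.Closed) {G : Ctx} {a e t : Exp} {k : Kind}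
    (h : HasKind S (t :: G) e k) (ha : HasType S G a t) : HasKind S G (e.inst a) k :=
  h.subst hS (.scons ha)

theorem Judg.of_substOk_var (hS : S.Closed) {G G' : Ctx} {e : Exp} {c : Cls} (h : Judg S G e c)
    (hs : SubstOk S G' .var G) : Judg S G' e c := by
  simpa only [Exp.subst_var, Cls.subst_var] using h.subst hS hs

theorem Judg.conv_ctx (hS : S.Closed) {G : Ctx} {e t t' : Exp} {c : Cls} {k : Kind}
    (h : Judg S (t :: G) e c) (ht : TyEquiv S t' t) (hk : HasKind S G t k) :
    Judg S (t' :: G) e c :=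
  h.of_substOk_var hS fun
    | 0, _, rfl => by
      rw [Exp.subst_var]
      refine .tConv (.tVar rfl) ?_ (hk.shift_kd hS _)
      simp only [Exp.rename_eq_subst]
      exact ht.subst hS _
    | i + 1, t₁, h₁ => by
      rw [Exp.subst_var]
      exact .tVar h₁

theorem Judg.weaken_nil (hS : S.Closed) {e : Exp} {c : Cls} (h : Judg S [] e c) (G : Ctx) :
    Judg S G e c :=
  h.of_substOk_var hS fun i t ht => by simp at ht

theorem Judg.weaken_singleton (hS : S.Closed) {e t : Exp} {c : Cls} (h : Judg S [t] e c)
    (G : Ctx) : Judg S (t :: G) e c :=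
  h.of_substOk_var hS fun
    | 0, _, rfl => (Exp.subst_var _).symm ▸ .tVar rfl


/-! ### Inversion and regularity -/

/-- What a judgment about an expression says about its immediate subexpressions, up to subkinding
and type equivalence, for the term formers that start a value or a type in normal form and for
`mux`. -/
def Inv (S : GCtx) (G : Ctx) : Exp → Cls → Prop
  | .prod t₁ t₂, .kd k => HasKind S G t₁ k ∧ HasKind S G t₂ k
  | .osum t₁ t₂, .kd _ => HasKind S G t₁ .obl ∧ HasKind S G t₂ .obl
  | .pi t₁ t₂, .kd k => k = .mix ∧ ∃ k₁ k₂, HasKind S G t₁ k₁ ∧ HasKind S (t₁ :: G) t₂ k₂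
  | .psi _, .kd k => k = .mix
  | .boolT, .kd k => k = .pub ∨ k = .mix
  | .adt _, .kd k => k = .pub ∨ k = .mix
  | .unit, .ty t => TyEquiv S .unitT t
  | .lit _, .ty t => TyEquiv S .boolT t
  | .boxLit _, .ty t => TyEquiv S .oboolT t
  | .boxInj b w u, .ty t => OValTy (.boxInj b w u) w ∧ TyEquiv S w.toExp t
  | .lam t₁ e, .ty t =>
    ∃ t₂ k, HasType S (t₁ :: G) e t₂ ∧ HasKind S G t₁ k ∧ TyEquiv S (.pi t₁ t₂) t
  | .pair e₁ e₂, .ty t =>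
    ∃ t₁ t₂, HasType S G e₁ t₁ ∧ HasType S G e₂ t₂ ∧ TyEquiv S (.prod t₁ t₂) t
  | .psiPair e₁ e₂, .ty t => ∃ T t₁ t₁', S T = some (.obliv t₁ t₁') ∧ HasType S G e₁ t₁ ∧
      HasType S G e₂ (.oapp T e₁) ∧ TyEquiv S (.psi T) t
  | .ctor c e, .ty t => ∃ T n, ∃ C : Fin n ↪ CName, ∃ ts i, S T = some (.data n C ts) ∧
      c = C i ∧ HasType S G e (ts i) ∧ TyEquiv S (.adt T) t
  | .boxInj _ _ _, .kd _ => False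
  | .mux _ e₁ e₂, _ => ∃ t, HasKind S G t .obl ∧ HasType S G e₁ t ∧ HasType S G e₂ t
  | _, _ => True

theorem Inv.kSub {G : Ctx} {e : Exp} {k k' : Kind} (h : Inv S G e (.kd k)) (hk : k.Le k') :
    Inv S G e (.kd k') := by
  cases e <;> try trivial
  case prod => exact ⟨.kSub h.1 hk, .kSub h.2 hk⟩
  all_goals
    simp only [Inv] at h ⊢
    cases hk <;> simp_all

theorem Inv.tConv {G : Ctx} {e t t' : Exp} (h : Inv S G e (.ty t)) (he : TyEquiv S t t') :
    Inv S G e (.ty t') := by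
  cases e <;> try trivial
  case unit | lit | boxLit => exact TyEquiv.trans h he
  case boxInj => exact ⟨h.1, h.2.trans he⟩
  case lam | pair =>
    obtain ⟨_, _, h₁, h₂, h₃⟩ := h
    exact ⟨_, _, h₁, h₂, h₃.trans he⟩
  case psiPair =>
    obtain ⟨_, _, _, h₀, h₁, h₂, h₃⟩ := h
    exact ⟨_, _, _, h₀, h₁, h₂, h₃.trans he⟩
  case ctor =>
    obtain ⟨_, _, _, _, _, h₀, h₁, h₂, h₃⟩ := h
    exact ⟨_, _, _, _, _, h₀, h₁, h₂, h₃.trans he⟩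

theorem Judg.inv {G : Ctx} {e : Exp} {c : Cls} (h : Judg S G e c) : Inv S G e c := by
  induction h with
  | kSub _ hk ih => exact ih.kSub hk
  | tConv _ he _ ih _ => exact ih.tConv he
  | kBool | kADT => exact .inl rfl
  | kPsi => rfl
  | kPi h₁ h₂ => exact ⟨rfl, _, _, h₁, h₂⟩
  | kProd h₁ h₂ | kOSum h₁ h₂ => exact ⟨h₁, h₂⟩
  | tUnit | tLit | tBoxLit => exact TyEquiv.refl _
  | tBoxInj h => exact ⟨h, .refl _⟩
  | tAbs h₁ h₂ | tPair h₁ h₂ => exact ⟨_, _, h₁, h₂, .refl _⟩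
  | tPsiPair h h₁ h₂ => exact ⟨_, _, _, h, h₁, h₂, .refl _⟩
  | tCtor h h₁ => exact ⟨_, _, _, _, _, h, rfl, h₁, .refl _⟩
  | tMux _ h h₁ h₂ => exact ⟨_, h, h₁, h₂⟩
  | _ => trivial

theorem Judg.lam_inv (hS : S.Closed) {G : Ctx} {t e t₁ t₂ : Exp}
    (h : HasType S G (.lam t e) (.pi t₁ t₂)) :
    ∃ t₂' k, HasType S (t :: G) e t₂' ∧ HasKind S G t k ∧ TyEquiv S t t₁ ∧ TyEquiv S t₂' t₂ := by
  obtain ⟨t₂', k, he, hk, heq⟩ := h.inv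
  cases heq.congr hS (.pi _ _) (.pi _ _) with
  | pi h₁ h₂ => exact ⟨t₂', k, he, hk, h₁, h₂⟩

theorem Judg.pair_inv (hS : S.Closed) {G : Ctx} {e₁ e₂ t₁ t₂ : Exp}
    (h : HasType S G (.pair e₁ e₂) (.prod t₁ t₂)) :
    ∃ t₁' t₂', HasType S G e₁ t₁' ∧ HasType S G e₂ t₂' ∧ TyEquiv S t₁' t₁ ∧ TyEquiv S t₂' t₂ := by
  obtain ⟨t₁', t₂', h₁, h₂, heq⟩ := h.inv
  cases heq.congr hS (.prod _ _) (.prod _ _) with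
  | prod he₁ he₂ => exact ⟨t₁', t₂', h₁, h₂, he₁, he₂⟩

theorem Judg.psiPair_inv (hS : S.Closed) {G : Ctx} {e₁ e₂ t t' : Exp} {T : Name}
    (h : HasType S G (.psiPair e₁ e₂) (.psi T)) (hT : S T = some (.obliv t t')) :
    HasType S G e₁ t ∧ HasType S G e₂ (.oapp T e₁) := by
  obtain ⟨T', _, _, hT', h₁, h₂, heq⟩ := h.inv
  cases heq.congr hS (.psi _) (.psi _)
  cases hT.symm.trans hT'
  exact ⟨h₁, h₂⟩

theorem Judg.ctor_inv (hS : S.Closed) {G : Ctx} {T : Name} {n : ℕ} {C : Fin n ↪ CName}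
    {ts : Fin n → Exp} {i : Fin n} {e : Exp} (h : HasType S G (.ctor (C i) e) (.adt T))
    (hT : S T = some (.data n C ts)) : HasType S G e (ts i) := by
  obtain ⟨T', _, C', _, j, hT', hC, he, heq⟩ := h.inv
  cases heq.congr hS (.adt _) (.adt _)
  cases hT.symm.trans hT'
  cases C.injective hC
  exact he

theorem Judg.not_pair_psi (hS : S.Closed) {G : Ctx} {e₁ e₂ : Exp} {T : Name} :
    ¬ HasType S G (.pair e₁ e₂) (.psi T) := fun h => by
  obtain ⟨_, _, _, _, heq⟩ := h.inv
  cases heq.congr hS (.prod _ _) (.psi _)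

theorem Judg.not_psiPair_prod (hS : S.Closed) {G : Ctx} {e₁ e₂ t₁ t₂ : Exp} :
    ¬ HasType S G (.psiPair e₁ e₂) (.prod t₁ t₂) := fun h => by
  obtain ⟨_, _, _, _, _, _, heq⟩ := h.inv
  cases heq.congr hS (.psi _) (.prod _ _)

/-- The expression `t` has some kind. -/
def WellKinded (S : GCtx) (G : Ctx) (t : Exp) : Prop := ∃ k, HasKind S G t k

theorem WellKinded.conv {G : Ctx} {e t t' : Exp} (h : WellKinded S G t') (he : HasType S G e t)
    (ht : TyEquiv S t t') : HasType S G e t' :=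
  let ⟨_, hk⟩ := h
  .tConv he ht hk

/-- Well-formed contexts: every type is well-kinded under the variables bound before it. -/
inductive WfCtx (S : GCtx) : Ctx → Prop
  | nil : WfCtx S []
  | cons {G : Ctx} {t : Exp} {k : Kind} : HasKind S G t k → WfCtx S G → WfCtx S (t :: G)

theorem WfCtx.wellKinded (hS : S.Closed) {G : Ctx} (h : WfCtx S G) {i : ℕ} {t : Exp}
    (ht : G[i]? = some t) : WellKinded S G (t.rename (· + (i + 1))) := by
  induction h generalizing i with
  | nil => simp at ht
  | cons hk _ ih =>
    cases i with
    | zero =>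
      cases ht
      exact ⟨_, hk.shift_kd hS _⟩
    | succ i =>
      obtain ⟨k, h⟩ := ih ht
      rw [Exp.rename_add_two]
      exact ⟨k, h.shift_kd hS _⟩

theorem OTy.hasKind_toExp {G : Ctx} (w : OTy) : HasKind S G w.toExp .obl := by
  induction w with
  | unit => exact .kSub .kUnit (.any_le _)
  | obool => exact .kOBool
  | prod _ _ h₁ h₂ => exact .kProd h₁ h₂
  | osum _ _ h₁ h₂ => exact .kOSum h₁ h₂

theorem GCtx.Ok.hasKind_of_data (hS : S.Ok) {T : Name} {n : ℕ} {C : Fin n ↪ CName}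
    {ts : Fin n → Exp} (h : S T = some (.data n C ts)) (i : Fin n) (G : Ctx) :
    HasKind S G (ts i) .pub := by
  cases hS _ _ h with
  | data h => exact (h i).weaken_nil hS.closed G

theorem GCtx.Ok.hasKind_of_obliv (hS : S.Ok) {T : Name} {t t' : Exp}
    (h : S T = some (.obliv t t')) (G : Ctx) :
    HasKind S G t .pub ∧ HasKind S (t :: G) t' .obl := by
  cases hS _ _ h with
  | obliv h₁ h₂ => exact ⟨h₁.weaken_nil hS.closed G, h₂.weaken_singleton hS.closed G⟩

/-- The right-hand side of a judgment makes sense: if it is a type then it is well-kinded. -/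
def Cls.Wf (S : GCtx) (G : Ctx) : Cls → Prop
  | .ty t => WellKinded S G t
  | .kd _ => True

theorem Judg.regular (hS : S.Ok) {G : Ctx} {e : Exp} {c : Cls} (h : Judg S G e c)
    (hG : WfCtx S G) : c.Wf S G := by
  induction h with
  | kSub | kUnit | kBool | kOBool | kADT | kOADT | kPi | kProd | kOSum | kPsi | kLet | kIf
  | kMatch => trivial
  | tConv _ _ h | tMux _ h | tOInj _ h | tOMatch _ h | tIf _ _ _ h | tMatch _ _ _ h =>
    exact ⟨_, h⟩
  | tUnit => exact ⟨_, .kUnit⟩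
  | tLit => exact ⟨_, .kBool⟩
  | tVar h => exact hG.wellKinded hS.closed h
  | tFun h =>
    cases hS _ _ h with
    | fn h => exact ⟨_, h.weaken_nil hS.closed _⟩
  | tAbs _ h ih =>
    obtain ⟨_, h'⟩ := ih (.cons h hG)
    exact ⟨_, .kPi h h'⟩
  | tApp _ h ih =>
    obtain ⟨_, h'⟩ := ih hG
    obtain ⟨_, _, _, _, h'⟩ := h'.inv
    exact ⟨_, h'.inst_kd hS.closed h⟩
  | tLet h _ ih₁ ih₂ =>
    obtain ⟨_, h₁⟩ := ih₁ hG
    obtain ⟨_, h₂⟩ := ih₂ (.cons h₁ hG)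
    exact ⟨_, h₂.inst_kd hS.closed h⟩
  | tPair _ _ ih₁ ih₂ =>
    obtain ⟨_, h₁⟩ := ih₁ hG
    obtain ⟨_, h₂⟩ := ih₂ hG
    exact ⟨_, .kProd (.kSub h₁ (.le_mix _)) (.kSub h₂ (.le_mix _))⟩
  | @tProj _ b _ _ _ _ ih =>
    obtain ⟨k, h⟩ := ih hG
    cases b
    · exact ⟨k, h.inv.2⟩
    · exact ⟨k, h.inv.1⟩
  | tCtor h => exact ⟨_, .kADT h⟩
  | tPsiPair h => exact ⟨_, .kPsi h⟩
  | tPsiProj₁ h => exact ⟨_, (hS.hasKind_of_obliv h _).1⟩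
  | tPsiProj₂ h h' => exact ⟨_, .kOADT h (.tPsiProj₁ h h')⟩
  | tSec | tBoxLit => exact ⟨_, .kOBool⟩
  | tBoxInj => exact ⟨_, OTy.hasKind_toExp _⟩

theorem OValTy.hasType {G : Ctx} {u : OVal} {w : OTy} (h : OValTy u w) :
    HasType S G u.toExp w.toExp := by
  induction h with
  | unit => exact .tUnit
  | obool => exact .tBoxLit
  | prod _ _ h₁ h₂ => exact .tPair h₁ h₂
  | osum h _ => exact .tBoxInj (.osum h)

theorem OValTy.of_hasType (hS : S.Closed) {G : Ctx} {u : OVal} {w : OTy} {t : Exp}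
    (h : HasType S G u.toExp t) (ht : TyEquiv S t w.toExp) : OValTy u w := by
  induction u generalizing w t with
  | unit =>
    cases OTy.eq_of_tyEquiv hS (w := .unit) (TyEquiv.trans h.inv ht)
    exact .unit
  | boxLit =>
    cases OTy.eq_of_tyEquiv hS (w := .obool) (TyEquiv.trans h.inv ht)
    exact .obool _
  | pair _ _ ih₁ ih₂ =>
    obtain ⟨_, _, h₁, h₂, heq⟩ := h.inv
    cases w <;> cases (heq.trans ht).congr hS (.prod _ _) (OTy.tyFormer_toExp _)
    rename_i he₁ he₂
    exact .prod (ih₁ h₁ he₁) (ih₂ h₂ he₂)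
  | boxInj =>
    obtain ⟨hu, heq⟩ := h.inv
    rwa [← OTy.eq_of_tyEquiv hS (heq.trans ht)]

/-! ### Preservation -/

/-- Every parallel reduct of `e` (hence also `e` itself) satisfies the judgment `e : c`. -/
def Preserved (S : GCtx) (G : Ctx) (e : Exp) (c : Cls) : Prop := ∀ e', Pared S e e' → Judg S G e' c

theorem Preserved.judg {G : Ctx} {e : Exp} {c : Cls} (h : Preserved S G e c) : Judg S G e c :=
  h e (.refl e)

theorem Preserved.wellKinded (hS : S.Ok) {G : Ctx} (hG : WfCtx S G) {e t : Exp}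
    (h : Preserved S G e (.ty t)) : WellKinded S G t :=
  h.judg.regular hS hG

theorem Preserved.kOADT (hS : S.Ok) {G : Ctx} {T : Name} {t t' e : Exp}
    (hT : S T = some (.obliv t t')) (h : Preserved S G e (.ty t)) :
    Preserved S G (.oapp T e) (.kd .obl) := fun e' hp =>
  match e', hp.congr_or_contract with
  | _, .inl (.oapp hp) => .kOADT hT (h _ hp)
  | _, .inr (.oadt hT' hp) => by
    cases hT.symm.trans hT'
    exact (hS.hasKind_of_obliv hT _).2.inst_kd hS.closed (h _ hp)

theorem Preserved.kPi (hS : S.Closed) {G : Ctx} {t₁ t₂ : Exp} {k₁ k₂ : Kind}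
    (h₁ : Preserved S G t₁ (.kd k₁)) (h₂ : Preserved S (t₁ :: G) t₂ (.kd k₂)) :
    Preserved S G (.pi t₁ t₂) (.kd .mix) := fun e' hp =>
  match e', hp.congr_or_contract with
  | _, .inl (.pi hp₁ hp₂) =>
    .kPi (h₁ _ hp₁) ((h₂ _ hp₂).conv_ctx hS hp₁.tyEquiv.symm h₁.judg)

theorem Preserved.kLet (hS : S.Closed) {G : Ctx} {e t t' : Exp} (h : Preserved S G e (.ty t))
    (h' : Preserved S (t :: G) t' (.kd .obl)) :
    Preserved S G (.letE e t') (.kd .obl) := fun e' hp =>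
  match e', hp.congr_or_contract with
  | _, .inl (.letE hp hp') => .kLet (h _ hp) (h' _ hp')
  | _, .inr (.letBeta hp hp') => (h' _ hp').inst_kd hS (h _ hp)

theorem Judg.cond {G : Ctx} {e₁ e₂ : Exp} {c : Cls} (h₁ : Judg S G e₁ c) (h₂ : Judg S G e₂ c)
    (b : Bool) : Judg S G (cond b e₁ e₂) c := by
  cases b <;> assumption

theorem Preserved.kIf {G : Ctx} {e₀ t₁ t₂ : Exp} (h₀ : Preserved S G e₀ (.ty .boolT))
    (h₁ : Preserved S G t₁ (.kd .obl)) (h₂ : Preserved S G t₂ (.kd .obl)) :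
    Preserved S G (.ite e₀ t₁ t₂) (.kd .obl) := fun e' hp =>
  match e', hp.congr_or_contract with
  | _, .inl (.ite hp₀ hp₁ hp₂) => .kIf (h₀ _ hp₀) (h₁ _ hp₁) (h₂ _ hp₂)
  | _, .inr (.iteLit hp₁ hp₂) => .cond (h₁ _ hp₁) (h₂ _ hp₂) _

theorem Preserved.kMatch (hS : S.Closed) {G : Ctx} {T : Name} {n : ℕ} {C : Fin n ↪ CName}
    {ts ts' : Fin n → Exp} {e₀ : Exp} (hT : S T = some (.data n C ts))
    (h₀ : Preserved S G e₀ (.ty (.adt T)))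
    (h : ∀ i, Preserved S (ts i :: G) (ts' i) (.kd .obl)) :
    Preserved S G (.cases n C e₀ ts') (.kd .obl) := fun e' hp =>
  match e', hp.congr_or_contract with
  | _, .inl (.cases hp₀ hp) => .kMatch hT (h₀ _ hp₀) fun i => h i _ (hp i)
  | _, .inr (.casesCtor rfl hp₀ hp) =>
    (h _ _ (hp _)).inst_kd hS ((h₀ _ (.ctor hp₀)).ctor_inv hS hT)

theorem Preserved.tFun (hS : S.Ok) {G : Ctx} {x : Name} {t e : Exp} (hx : S x = some (.fn t e)) :
    Preserved S G (.gfun x) (.ty t) := fun e' hp =>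
  match e', hp.congr_or_contract with
  | _, .inl (.gfun _) => .tFun hx
  | _, .inr (.fn hx') => by
    cases hx.symm.trans hx'
    cases hS _ _ hx with
    | fn _ he => exact he.weaken_nil hS.closed G

theorem Preserved.tAbs (hS : S.Ok) {G : Ctx} (hG : WfCtx S G) {t₁ t₂ e : Exp} {k : Kind}
    (h : Preserved S (t₁ :: G) e (.ty t₂)) (h₁ : Preserved S G t₁ (.kd k)) :
    Preserved S G (.lam t₁ e) (.ty (.pi t₁ t₂)) := fun e' hp =>
  match e', hp.congr_or_contract with
  | _, .inl (.lam hp₁ hp) => by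
    have hk : WellKinded S G (.pi t₁ t₂) := (Judg.tAbs h.judg h₁.judg).regular hS hG
    refine hk.conv
      (.tAbs ((h _ hp).conv_ctx hS.closed hp₁.tyEquiv.symm h₁.judg) (h₁ _ hp₁)) ?_
    exact hp₁.tyEquiv.symm.map fun hp => .pi hp (.refl _)

theorem Preserved.tApp (hS : S.Ok) {G : Ctx} (hG : WfCtx S G) {t₁ t₂ e₁ e₂ : Exp}
    (h₂ : Preserved S G e₂ (.ty (.pi t₁ t₂))) (h₁ : Preserved S G e₁ (.ty t₁)) :
    Preserved S G (.app e₂ e₁) (.ty (t₂.inst e₁)) := fun e' hp => by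
  have hC := hS.closed
  have hk : WellKinded S G (t₂.inst e₁) := (Judg.tApp h₂.judg h₁.judg).regular hS hG
  match e', hp.congr_or_contract with
  | _, .inl (.app hp₂ hp₁) =>
    exact hk.conv (.tApp (h₂ _ hp₂) (h₁ _ hp₁)) (.inst hC (.refl _) hp₁.tyEquiv.symm)
  | _, .inr (.beta hp₂ hp₁) =>
    obtain ⟨t₂', k, hb, hk', he₁, he₂⟩ := (h₂ _ (.lam (.refl _) hp₂)).lam_inv hC
    have ha := Judg.tConv (h₁ _ hp₁) he₁.symm hk'
    exact hk.conv (hb.inst_ty hC ha) (.inst hC he₂ hp₁.tyEquiv.symm)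

theorem Preserved.tLet (hS : S.Ok) {G : Ctx} (hG : WfCtx S G) {t₁ t₂ e₁ e₂ : Exp}
    (h₁ : Preserved S G e₁ (.ty t₁)) (h₂ : Preserved S (t₁ :: G) e₂ (.ty t₂)) :
    Preserved S G (.letE e₁ e₂) (.ty (t₂.inst e₁)) := fun e' hp => by
  have hC := hS.closed
  have hk : WellKinded S G (t₂.inst e₁) := (Judg.tLet h₁.judg h₂.judg).regular hS hG
  match e', hp.congr_or_contract with
  | _, .inl (.letE hp₁ hp₂) =>
    exact hk.conv (.tLet (h₁ _ hp₁) (h₂ _ hp₂)) (.inst hC (.refl _) hp₁.tyEquiv.symm)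
  | _, .inr (.letBeta hp₁ hp₂) =>
    exact hk.conv ((h₂ _ hp₂).inst_ty hC (h₁ _ hp₁)) (.inst hC (.refl _) hp₁.tyEquiv.symm)

theorem Preserved.tProj (hS : S.Ok) {G : Ctx} (hG : WfCtx S G) {b : Bool} {t₁ t₂ e : Exp}
    (h : Preserved S G e (.ty (.prod t₁ t₂))) :
    Preserved S G (.proj b e) (.ty (cond b t₁ t₂)) := fun e' hp => by
  have hC := hS.closed
  match e', hp.congr_or_contract with
  | _, .inl (.proj hp) => exact .tProj (h _ hp)
  | _, .inr (.projPair hp₁ hp₂) =>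
    have hk : WellKinded S G (bif b then t₁ else t₂) := (Judg.tProj h.judg).regular hS hG
    obtain ⟨t₁', t₂', h₁, h₂, he₁, he₂⟩ := (h _ (.pair hp₁ hp₂)).pair_inv hC
    cases b
    · exact hk.conv h₂ he₂
    · exact hk.conv h₁ he₁
  | _, .inr (.projPsiPair _ _) => exact (Judg.not_psiPair_prod hC h.judg).elim

theorem Preserved.tIf (hS : S.Closed) {G : Ctx} {e₀ e₁ e₂ t : Exp} {k : Kind}
    (h₀ : Preserved S G e₀ (.ty .boolT)) (h₁ : Preserved S G e₁ (.ty (t.inst (.lit true))))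
    (h₂ : Preserved S G e₂ (.ty (t.inst (.lit false))))
    (hk : Preserved S G (t.inst e₀) (.kd k)) :
    Preserved S G (.ite e₀ e₁ e₂) (.ty (t.inst e₀)) := fun e' hp => by
  match e', hp.congr_or_contract with
  | _, .inl (.ite hp₀ hp₁ hp₂) =>
    have hpt := Pared.inst hS (.refl t) hp₀
    exact .tConv (.tIf (h₀ _ hp₀) (h₁ _ hp₁) (h₂ _ hp₂) (hk _ hpt)) hpt.tyEquiv.symm hk.judg
  | _, .inr (.iteLit (b := b) hp₁ hp₂) =>
    cases b
    · exact h₂ _ hp₂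
    · exact h₁ _ hp₁

theorem Preserved.tMatch (hS : S.Closed) {G : Ctx} {T : Name} {n : ℕ} {C : Fin n ↪ CName}
    {ts es : Fin n → Exp} {e₀ t : Exp} {k : Kind} (hT : S T = some (.data n C ts))
    (h₀ : Preserved S G e₀ (.ty (.adt T)))
    (h : ∀ i, Preserved S (ts i :: G) (es i) (.ty (t.instCtor (C i))))
    (hk : Preserved S G (t.inst e₀) (.kd k)) :
    Preserved S G (.cases n C e₀ es) (.ty (t.inst e₀)) := fun e' hp => by
  match e', hp.congr_or_contract with
  | _, .inl (.cases hp₀ hp) =>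
    have hpt := Pared.inst hS (.refl t) hp₀
    exact .tConv (.tMatch hT (h₀ _ hp₀) (fun i => h i _ (hp i)) (hk _ hpt)) hpt.tyEquiv.symm
      hk.judg
  | _, .inr (.casesCtor (i := i) rfl hp₀ hp) =>
    have he := (h i _ (hp i)).inst_ty hS ((h₀ _ (.ctor hp₀)).ctor_inv hS hT)
    rw [Exp.inst_instCtor] at he
    exact .tConv he (.inst hS (.refl _) hp₀.ctor.tyEquiv.symm) hk.judg

theorem Preserved.tPsiPair {G : Ctx} {T : Name} {t t' e₁ e₂ : Exp}
    (hT : S T = some (.obliv t t')) (h₁ : Preserved S G e₁ (.ty t))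
    (h₂ : Preserved S G e₂ (.ty (.oapp T e₁))) :
    Preserved S G (.psiPair e₁ e₂) (.ty (.psi T)) := fun e' hp =>
  match e', hp.congr_or_contract with
  | _, .inl (.psiPair hp₁ hp₂) =>
    .tPsiPair hT (h₁ _ hp₁) (.tConv (h₂ _ hp₂) hp₁.oapp.tyEquiv (.kOADT hT (h₁ _ hp₁)))

theorem Preserved.tPsiProj₁ (hS : S.Closed) {G : Ctx} {T : Name} {t t' e : Exp}
    (hT : S T = some (.obliv t t')) (h : Preserved S G e (.ty (.psi T))) :
    Preserved S G (.proj true e) (.ty t) := fun e' hp =>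
  match e', hp.congr_or_contract with
  | _, .inl (.proj hp) => .tPsiProj₁ hT (h _ hp)
  | _, .inr (.projPair _ _) => (Judg.not_pair_psi hS h.judg).elim
  | _, .inr (.projPsiPair hp₁ hp₂) => ((h _ (.psiPair hp₁ hp₂)).psiPair_inv hS hT).1

theorem Preserved.tPsiProj₂ (hS : S.Ok) {G : Ctx} (hG : WfCtx S G) {T : Name} {t t' e : Exp}
    (hT : S T = some (.obliv t t')) (h : Preserved S G e (.ty (.psi T))) :
    Preserved S G (.proj false e) (.ty (.oapp T (.proj true e))) := fun e' hp => by
  have hk : WellKinded S G (.oapp T (.proj true e)) := (Judg.tPsiProj₂ hT h.judg).regular hS hG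
  match e', hp.congr_or_contract with
  | _, .inl (.proj hp) => exact hk.conv (.tPsiProj₂ hT (h _ hp)) hp.proj.oapp.tyEquiv.symm
  | _, .inr (.projPair _ _) => exact (Judg.not_pair_psi hS.closed h.judg).elim
  | _, .inr (.projPsiPair hp₁ hp₂) =>
    exact hk.conv ((h _ (.psiPair hp₁ hp₂)).psiPair_inv hS.closed hT).2
      (Pared.oapp (.projPsiPair (b := true) hp₁ hp₂)).tyEquiv.symm

theorem Preserved.tMux {G : Ctx} {t e₀ e₁ e₂ : Exp} (h₀ : Preserved S G e₀ (.ty .oboolT))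
    (hk : HasKind S G t .obl) (h₁ : Preserved S G e₁ (.ty t)) (h₂ : Preserved S G e₂ (.ty t)) :
    Preserved S G (.mux e₀ e₁ e₂) (.ty t) := fun e' hp =>
  match e', hp.congr_or_contract with
  | _, .inl (.mux hp₀ hp₁ hp₂) => .tMux (h₀ _ hp₀) hk (h₁ _ hp₁) (h₂ _ hp₂)
  | _, .inr (.muxBox hp₁ hp₂) => .cond (h₁ _ hp₁) (h₂ _ hp₂) _

theorem Preserved.tOInj (hS : S.Closed) {G : Ctx} {b : Bool} {t₁ t₂ e : Exp}
    (h : Preserved S G e (.ty (cond b t₁ t₂))) (hk : Preserved S G (.osum t₁ t₂) (.kd .obl)) :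
    Preserved S G (.oinj b (.osum t₁ t₂) e) (.ty (.osum t₁ t₂)) := fun e' hp => by
  match e', hp.congr_or_contract with
  | _, .inl (.oinj hp₁ hp₂) =>
    match hp₁.congr_or_contract with
    | .inl (.osum hq₁ hq₂) =>
      have hk' := hk _ hp₁
      refine .tConv (.tOInj ?_ hk') hp₁.tyEquiv.symm hk.judg
      cases b
      · exact .tConv (h _ hp₂) hq₂.tyEquiv hk'.inv.2
      · exact .tConv (h _ hp₂) hq₁.tyEquiv hk'.inv.1
  | _, .inr (.oinjBox (w := .osum w₁ w₂) rfl rfl) =>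
    refine .tBoxInj (.osum (.of_hasType hS h.judg ?_))
    cases b <;> exact .refl _

theorem Preserved.tOMatch (hS : S.Ok) {G : Ctx} {t₁ t₂ t e₀ e₁ e₂ : Exp} (hG : WfCtx S G)
    (h₀ : Preserved S G e₀ (.ty (.osum t₁ t₂))) (hk : HasKind S G t .obl)
    (h₁ : Preserved S (t₁ :: G) e₁ (.ty t.shift)) (h₂ : Preserved S (t₂ :: G) e₂ (.ty t.shift)) :
    Preserved S G (.omatch e₀ e₁ e₂) (.ty t) := fun e' hp => by
  match e', hp.congr_or_contract with
  | _, .inl (.omatch hp₀ hp₁ hp₂) => exact .tOMatch (h₀ _ hp₀) hk (h₁ _ hp₁) (h₂ _ hp₂)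
  | _, .inr (.omatchBox (b := b) hu₁ hu₂ hp₁ hp₂) =>
    obtain ⟨_, hks⟩ := h₀.wellKinded hS hG
    obtain ⟨hu, heq⟩ := h₀.judg.inv
    cases heq.congr hS.closed (.osum _ _) (.osum _ _) with
    | osum he₁ he₂ =>
    have hi₁ {u} (hu : OValTy u _) := (h₁ _ hp₁).inst_ty hS.closed (.tConv hu.hasType he₁ hks.inv.1)
    have hi₂ {u} (hu : OValTy u _) := (h₂ _ hp₂).inst_ty hS.closed (.tConv hu.hasType he₂ hks.inv.2)
    simp only [Exp.inst_shift] at hi₁ hi₂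
    cases hu with
    | osum hu =>
      cases b
      · exact .tMux .tBoxLit hk (hi₁ hu₁) (hi₂ hu)
      · exact .tMux .tBoxLit hk (hi₁ hu) (hi₂ hu₂)

theorem Preserved.kProd {G : Ctx} {t₁ t₂ : Exp} {k : Kind} (h₁ : Preserved S G t₁ (.kd k))
    (h₂ : Preserved S G t₂ (.kd k)) : Preserved S G (.prod t₁ t₂) (.kd k) := fun e' hp =>
  match e', hp.congr_or_contract with
  | _, .inl (.prod hp₁ hp₂) => .kProd (h₁ _ hp₁) (h₂ _ hp₂)

theorem Preserved.kOSum {G : Ctx} {t₁ t₂ : Exp} (h₁ : Preserved S G t₁ (.kd .obl))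
    (h₂ : Preserved S G t₂ (.kd .obl)) : Preserved S G (.osum t₁ t₂) (.kd .obl) := fun e' hp =>
  match e', hp.congr_or_contract with
  | _, .inl (.osum hp₁ hp₂) => .kOSum (h₁ _ hp₁) (h₂ _ hp₂)

theorem Preserved.tPair {G : Ctx} {t₁ t₂ e₁ e₂ : Exp} (h₁ : Preserved S G e₁ (.ty t₁))
    (h₂ : Preserved S G e₂ (.ty t₂)) : Preserved S G (.pair e₁ e₂) (.ty (.prod t₁ t₂)) :=
  fun e' hp => match e', hp.congr_or_contract with
  | _, .inl (.pair hp₁ hp₂) => .tPair (h₁ _ hp₁) (h₂ _ hp₂)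

theorem Preserved.tCtor {G : Ctx} {T : Name} {n : ℕ} {C : Fin n ↪ CName} {ts : Fin n → Exp}
    {i : Fin n} {e : Exp} (hT : S T = some (.data n C ts)) (h : Preserved S G e (.ty (ts i))) :
    Preserved S G (.ctor (C i) e) (.ty (.adt T)) := fun e' hp =>
  match e', hp.congr_or_contract with
  | _, .inl (.ctor hp) => .tCtor hT (h _ hp)

theorem Preserved.tSec {G : Ctx} {e : Exp} (h : Preserved S G e (.ty .boolT)) :
    Preserved S G (.sec e) (.ty .oboolT) := fun e' hp =>
  match e', hp.congr_or_contract with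
  | _, .inl (.sec hp) => .tSec (h _ hp)
  | _, .inr .secLit => .tBoxLit

theorem Judg.preserved (hS : S.Ok) {G : Ctx} {e : Exp} {c : Cls} (h : Judg S G e c)
    (hG : WfCtx S G) : Preserved S G e c := by
  have hC := hS.closed
  induction h with
  | kUnit => rintro _ ⟨⟩; exact .kUnit
  | kBool => rintro _ ⟨⟩; exact .kBool
  | kOBool => rintro _ ⟨⟩; exact .kOBool
  | kADT h => rintro _ ⟨⟩; exact .kADT h
  | kPsi h => rintro _ ⟨⟩; exact .kPsi h
  | tUnit => rintro _ ⟨⟩; exact .tUnit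
  | tLit => rintro _ ⟨⟩; exact .tLit
  | tVar h => rintro _ ⟨⟩; exact .tVar h
  | tBoxLit => rintro _ ⟨⟩; exact .tBoxLit
  | tBoxInj h => rintro _ ⟨⟩; exact .tBoxInj h
  | kSub _ hk ih => exact fun _ hp => .kSub (ih hG _ hp) hk
  | tConv _ he hk ih => exact fun _ hp => .tConv (ih hG _ hp) he hk
  | kProd _ _ ih₁ ih₂ => exact .kProd (ih₁ hG) (ih₂ hG)
  | kOSum _ _ ih₁ ih₂ => exact .kOSum (ih₁ hG) (ih₂ hG)
  | tPair _ _ ih₁ ih₂ => exact .tPair (ih₁ hG) (ih₂ hG)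
  | tCtor h _ ih => exact .tCtor h (ih hG)
  | tSec _ ih => exact .tSec (ih hG)
  | kOADT h _ ih => exact .kOADT hS h (ih hG)
  | kPi h₁ _ ih₁ ih₂ => exact .kPi hC (ih₁ hG) (ih₂ (.cons h₁ hG))
  | kLet h _ ih₁ ih₂ =>
    obtain ⟨_, hk⟩ := h.regular hS hG
    exact .kLet hC (ih₁ hG) (ih₂ (.cons hk hG))
  | kIf _ _ _ ih₀ ih₁ ih₂ => exact .kIf (ih₀ hG) (ih₁ hG) (ih₂ hG)
  | kMatch h _ _ ih₀ ih =>
    exact .kMatch hC h (ih₀ hG) fun i => ih i (.cons (hS.hasKind_of_data h i _) hG)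
  | tFun h => exact .tFun hS h
  | tAbs _ h ih₁ ih₂ => exact .tAbs hS hG (ih₁ (.cons h hG)) (ih₂ hG)
  | tApp _ _ ih₁ ih₂ => exact .tApp hS hG (ih₁ hG) (ih₂ hG)
  | tLet h _ ih₁ ih₂ =>
    obtain ⟨_, hk⟩ := h.regular hS hG
    exact .tLet hS hG (ih₁ hG) (ih₂ (.cons hk hG))
  | tProj _ ih => exact .tProj hS hG (ih hG)
  | tIf _ _ _ _ ih₀ ih₁ ih₂ ihk => exact .tIf hC (ih₀ hG) (ih₁ hG) (ih₂ hG) (ihk hG)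
  | tMatch h _ _ _ ih₀ ih ihk =>
    exact .tMatch hC h (ih₀ hG) (fun i => ih i (.cons (hS.hasKind_of_data h i _) hG)) (ihk hG)
  | tPsiPair h _ _ ih₁ ih₂ => exact .tPsiPair h (ih₁ hG) (ih₂ hG)
  | tPsiProj₁ h _ ih => exact .tPsiProj₁ hC h (ih hG)
  | tPsiProj₂ h _ ih => exact .tPsiProj₂ hS hG h (ih hG)
  | tMux _ hk _ _ ih₀ _ ih₁ ih₂ => exact .tMux (ih₀ hG) hk (ih₁ hG) (ih₂ hG)
  | tOInj _ _ ih ihk => exact .tOInj hC (ih hG) (ihk hG)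
  | tOMatch h₀ hk _ _ ih₀ _ ih₁ ih₂ =>
    obtain ⟨_, hks⟩ := h₀.regular hS hG
    exact .tOMatch hS hG (ih₀ hG) hk (ih₁ (.cons hks.inv.1 hG)) (ih₂ (.cons hks.inv.2 hG))

theorem Judg.pared (hS : S.Ok) {G : Ctx} {e e' : Exp} {c : Cls} (h : Judg S G e c)
    (hG : WfCtx S G) (hp : Pared S e e') : Judg S G e' c :=
  h.preserved hS hG e' hp

theorem Judg.pareds (hS : S.Ok) {G : Ctx} {e e' : Exp} {c : Cls} (h : Judg S G e c)
    (hG : WfCtx S G) (hp : Pareds S e e') : Judg S G e' c := by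
  induction hp with
  | refl => exact h
  | tail _ hp ih => exact ih.pared hS hG hp

/-! ### Values -/

theorem Value.indist {v v' : Exp} (hv : Value v) (h : Indist v v') : Value v' := by
  induction hv generalizing v' <;> cases h <;> constructor <;> solve_by_elim

theorem Value.not_step {v x : Exp} (hv : Value v) : ¬ Step S v x := by
  intro h
  induction hv generalizing x <;> cases h <;> solve_by_elim

theorem OVal.value_toExp (u : OVal) : Value u.toExp := by
  induction u <;> constructor <;> assumption

theorem OVal.exists_of_indist {u : OVal} {e : Exp} (h : Indist u.toExp e) :
    ∃ u' : OVal, e = u'.toExp := by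
  induction u generalizing e with
  | unit => cases h; exact ⟨.unit, rfl⟩
  | boxLit => cases h; exact ⟨.boxLit _, rfl⟩
  | boxInj => cases h; exact ⟨.boxInj _ _ _, rfl⟩
  | pair _ _ ih₁ ih₂ =>
    cases h with
    | pair h₁ h₂ =>
      obtain ⟨_, rfl⟩ := ih₁ h₁
      obtain ⟨_, rfl⟩ := ih₂ h₂
      exact ⟨.pair _ _, rfl⟩

theorem OTy.eq_of_indist {w : OTy} {e : Exp} (h : Indist w.toExp e) : e = w.toExp := by
  induction w generalizing e with
  | unit | obool => cases h; rfl
  | prod _ _ ih₁ ih₂ | osum _ _ ih₁ ih₂ =>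
    cases h
    rename_i h₁ h₂
    rw [ih₁ h₁, ih₂ h₂, toExp]

theorem OTy.not_step {w : OTy} {x : Exp} : ¬ Step S w.toExp x := by
  intro h
  induction w generalizing x with
  | unit | obool => cases h
  | prod w₁ w₂ ih₁ ih₂ =>
    rw [toExp] at h
    generalize hw : w₁.toExp = t₁ at h
    cases h with
    | cProd₁ h => exact ih₁ (hw ▸ h)
    | cProd₂ h => exact ih₂ h
  | osum w₁ w₂ ih₁ ih₂ =>
    rw [toExp] at h
    generalize hw : w₁.toExp = t₁ at h
    cases h with
    | cOSum₁ h => exact ih₁ (hw ▸ h)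
    | cOSum₂ h => exact ih₂ h

theorem TyEquiv.prod {t₁ t₁' t₂ t₂' : Exp} (h₁ : TyEquiv S t₁ t₁') (h₂ : TyEquiv S t₂ t₂') :
    TyEquiv S (.prod t₁ t₂) (.prod t₁' t₂') :=
  (h₁.map fun h => h.prod (.refl t₂)).trans (h₂.map fun h => (Pared.refl t₁').prod h)

theorem Judg.exists_kind_of_tyEquiv (hS : S.Ok) {G : Ctx} (hG : WfCtx S G) {t a : Exp} {k : Kind}
    (ht : HasKind S G t k) (ha : TyFormer a) (h : TyEquiv S a t) :
    ∃ a', HasKind S G a' k ∧ Congr (TyEquiv S) a a' :=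
  let ⟨a', hp, hc⟩ := h.symm.exists_pareds hS.closed ha
  ⟨a', ht.pareds hS hG hp, hc⟩

theorem Value.exists_ovalTy (hS : S.Ok) {G : Ctx} (hG : WfCtx S G) {v t : Exp} (hv : Value v)
    (ht : HasKind S G t .obl) (h : HasType S G v t) :
    ∃ u w, v = OVal.toExp u ∧ OValTy u w ∧ TyEquiv S w.toExp t := by
  induction hv generalizing t with
  | unit => exact ⟨.unit, .unit, rfl, .unit, h.inv⟩
  | boxLit b => exact ⟨.boxLit b, .obool, rfl, .obool b, h.inv⟩
  | boxInj b w u => exact ⟨.boxInj b w u, w, rfl, h.inv.1, h.inv.2⟩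
  | pair _ _ ih₁ ih₂ =>
    obtain ⟨t₁, t₂, h₁, h₂, he⟩ := h.inv
    obtain ⟨_, hk, ⟨⟩⟩ := ht.exists_kind_of_tyEquiv hS hG (.prod t₁ t₂) he
    rename_i he₁ he₂
    obtain ⟨u₁, w₁, rfl, hu₁, hw₁⟩ := ih₁ hk.inv.1 (.tConv h₁ he₁ hk.inv.1)
    obtain ⟨u₂, w₂, rfl, hu₂, hw₂⟩ := ih₂ hk.inv.2 (.tConv h₂ he₂ hk.inv.2)
    exact ⟨.pair u₁ u₂, .prod w₁ w₂, rfl, .prod hu₁ hu₂,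
      .trans (.prod (hw₁.trans he₁.symm) (hw₂.trans he₂.symm)) he⟩
  | lit =>
    obtain ⟨_, hk, ⟨⟩⟩ := ht.exists_kind_of_tyEquiv hS hG .boolT h.inv
    cases hk.inv <;> contradiction
  | psiPair =>
    obtain ⟨_, _, _, _, _, _, he⟩ := h.inv
    obtain ⟨_, hk, ⟨⟩⟩ := ht.exists_kind_of_tyEquiv hS hG (.psi _) he
    cases hk.inv
  | lam =>
    obtain ⟨_, _, _, _, he⟩ := h.inv
    obtain ⟨_, hk, ⟨⟩⟩ := ht.exists_kind_of_tyEquiv hS hG (.pi _ _) he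
    cases hk.inv.1
  | ctor =>
    obtain ⟨_, _, _, _, _, _, _, _, he⟩ := h.inv
    obtain ⟨_, hk, ⟨⟩⟩ := ht.exists_kind_of_tyEquiv hS hG (.adt _) he
    cases hk.inv <;> contradiction

theorem Value.indist_of_hasKind (hS : S.Ok) {G : Ctx} (hG : WfCtx S G) {v v' t : Exp}
    (hv : Value v) (hv' : Value v') (ht : HasKind S G t .obl) (h : HasType S G v t)
    (h' : HasType S G v' t) : Indist v v' := by
  obtain ⟨u, w, rfl, hu, he⟩ := hv.exists_ovalTy hS hG ht h
  obtain ⟨u', w', rfl, hu', he'⟩ := hv'.exists_ovalTy hS hG ht h'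
  cases OTy.eq_of_tyEquiv hS.closed (he.trans he'.symm)
  exact hu.indist hu'

/-! ### Evaluation frames and head steps -/

/-- Evaluation frames: the single layers of evaluation contexts, as functions of the hole. -/
inductive EvalFrame : (Exp → Exp) → Prop
  | prod₁ (t : Exp) : EvalFrame (.prod · t)
  | prod₂ (w : OTy) : EvalFrame (.prod w.toExp ·)
  | osum₁ (t : Exp) : EvalFrame (.osum · t)
  | osum₂ (w : OTy) : EvalFrame (.osum w.toExp ·)
  | letE (e : Exp) : EvalFrame (.letE · e)
  | app₂ (e : Exp) : EvalFrame (.app e ·)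
  | app₁ {v : Exp} : Value v → EvalFrame (.app · v)
  | ctor (C : CName) : EvalFrame (.ctor C ·)
  | oapp (T : Name) : EvalFrame (.oapp T ·)
  | ite (e₁ e₂ : Exp) : EvalFrame (.ite · e₁ e₂)
  | mux₀ (e₁ e₂ : Exp) : EvalFrame (.mux · e₁ e₂)
  | mux₁ {v₀ : Exp} (e₂ : Exp) : Value v₀ → EvalFrame (.mux v₀ · e₂)
  | mux₂ {v₀ v₁ : Exp} : Value v₀ → Value v₁ → EvalFrame (.mux v₀ v₁ ·)
  | pair₁ (e : Exp) : EvalFrame (.pair · e)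
  | pair₂ {v : Exp} : Value v → EvalFrame (.pair v ·)
  | psiPair₁ (e : Exp) : EvalFrame (.psiPair · e)
  | psiPair₂ {v : Exp} : Value v → EvalFrame (.psiPair v ·)
  | proj (b : Bool) : EvalFrame (.proj b ·)
  | oinj₁ (b : Bool) (e : Exp) : EvalFrame (.oinj b · e)
  | oinj₂ (b : Bool) (w : OTy) : EvalFrame (.oinj b w.toExp ·)
  | omatch (e₁ e₂ : Exp) : EvalFrame (.omatch · e₁ e₂)
  | cases (n : ℕ) (C : Fin n ↪ CName) (es : Fin n → Exp) : EvalFrame (.cases n C · es)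
  | sec : EvalFrame (.sec ·)

/-- The basic steps of `Step`, which contract a redex at the head.  The shape of a redex is imposed
by equations where constructor patterns could not be inverted. -/
inductive HeadStep (S : GCtx) : Exp → Exp → Prop
  | fn {x : Name} {t e : Exp} : S x = some (.fn t e) → HeadStep S (.gfun x) e
  | oadt {T : Name} {t t' v : Exp} :
      S T = some (.obliv t t') → Value v → HeadStep S (.oapp T v) (t'.inst v)
  | app {t e v : Exp} : Value v → HeadStep S (.app (.lam t e) v) (e.inst v)
  | letE {v e : Exp} : Value v → HeadStep S (.letE v e) (e.inst v)
  | ite {b : Bool} {e₁ e₂ : Exp} : HeadStep S (.ite (.lit b) e₁ e₂) (cond b e₁ e₂)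
  | mux {b : Bool} {v₁ v₂ : Exp} :
      Value v₁ → Value v₂ → HeadStep S (.mux (.boxLit b) v₁ v₂) (cond b v₁ v₂)
  | cases {n : ℕ} {C : Fin n ↪ CName} {i : Fin n} {e₀ v : Exp} {es : Fin n → Exp} :
      e₀ = .ctor (C i) v → Value v → HeadStep S (.cases n C e₀ es) ((es i).inst v)
  | proj {b : Bool} {v₁ v₂ : Exp} :
      Value v₁ → Value v₂ → HeadStep S (.proj b (.pair v₁ v₂)) (cond b v₁ v₂)
  | psiProj {b : Bool} {v₁ v₂ : Exp} :
      Value v₁ → Value v₂ → HeadStep S (.proj b (.psiPair v₁ v₂)) (cond b v₁ v₂)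
  | sec {b : Bool} : HeadStep S (.sec (.lit b)) (.boxLit b)
  | oinj {b : Bool} {w : OTy} {u : OVal} {t v : Exp} :
      t = w.toExp → v = u.toExp → HeadStep S (.oinj b t v) (.boxInj b w u)
  | omatch {b : Bool} {w₁ w₂ : OTy} {u u₁ u₂ : OVal} {e₁ e₂ : Exp} :
      OValTy u₁ w₁ → OValTy u₂ w₂ →
      HeadStep S (.omatch (.boxInj b (.osum w₁ w₂) u) e₁ e₂)
        (.mux (.boxLit b)
          (cond b (e₁.inst u.toExp) (e₁.inst u₁.toExp))
          (cond b (e₂.inst u₂.toExp) (e₂.inst u.toExp)))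

theorem EvalFrame.step {F : Exp → Exp} (hF : EvalFrame F) {e e' : Exp} (h : Step S e e') :
    Step S (F e) (F e') := by
  cases hF <;> constructor <;> assumption

theorem HeadStep.step {e e' : Exp} (h : HeadStep S e e') : Step S e e' := by
  cases h <;> subst_vars <;> constructor <;> assumption

theorem Step.induction_frame {P : Exp → Exp → Prop} {e e' : Exp} (h : Step S e e')
    (head : ∀ {e e'}, HeadStep S e e' → P e e')
    (frame : ∀ {F e e'}, EvalFrame F → Step S e e' → P e e' → P (F e) (F e')) : P e e' := by
  induction h with
  | cProd₁ h ih => exact frame (.prod₁ _) h ih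
  | cProd₂ h ih => exact frame (.prod₂ _) h ih
  | cOSum₁ h ih => exact frame (.osum₁ _) h ih
  | cOSum₂ h ih => exact frame (.osum₂ _) h ih
  | cLet h ih => exact frame (.letE _) h ih
  | cApp₂ h ih => exact frame (.app₂ _) h ih
  | cApp₁ hv h ih => exact frame (.app₁ hv) h ih
  | cCtor h ih => exact frame (.ctor _) h ih
  | cOApp h ih => exact frame (.oapp _) h ih
  | cIte h ih => exact frame (.ite _ _) h ih
  | cMux₀ h ih => exact frame (.mux₀ _ _) h ih
  | cMux₁ hv₀ h ih => exact frame (.mux₁ _ hv₀) h ih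
  | cMux₂ hv₀ hv₁ h ih => exact frame (.mux₂ hv₀ hv₁) h ih
  | cPair₁ h ih => exact frame (.pair₁ _) h ih
  | cPair₂ hv h ih => exact frame (.pair₂ hv) h ih
  | cPsiPair₁ h ih => exact frame (.psiPair₁ _) h ih
  | cPsiPair₂ hv h ih => exact frame (.psiPair₂ hv) h ih
  | cProj h ih => exact frame (.proj _) h ih
  | cOInj₁ h ih => exact frame (.oinj₁ _ _) h ih
  | cOInj₂ h ih => exact frame (.oinj₂ _ _) h ih
  | cOMatch h ih => exact frame (.omatch _ _) h ih
  | cCases h ih => exact frame (.cases _ _ _) h ih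
  | cSec h ih => exact frame .sec h ih
  | cases hv => exact head (.cases rfl hv)
  | oinj => exact head (.oinj rfl rfl)
  | _ => exact head (by constructor <;> assumption)

theorem EvalFrame.congr {R : Exp → Exp → Prop} (hR : ∀ e, R e e) {F : Exp → Exp}
    (hF : EvalFrame F) {e e' : Exp} (h : R e e') : Congr R (F e) (F e') := by
  cases hF <;> constructor <;> solve_by_elim

theorem Congr.pared {e e' : Exp} (h : Congr (Pared S) e e') : Pared S e e' := by
  cases h <;> constructor <;> assumption

theorem HeadStep.pared {e e' : Exp} (h : HeadStep S e e') : Pared S e e' := by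
  cases h with
  | fn h => exact .fn h
  | oadt h _ => exact .oadt h (.refl _)
  | app => exact .beta (.refl _) (.refl _)
  | letE => exact .letBeta (.refl _) (.refl _)
  | ite => exact .iteLit (.refl _) (.refl _)
  | mux => exact .muxBox (.refl _) (.refl _)
  | cases he => exact he ▸ .casesCtor (.refl _) fun _ => .refl _
  | proj => exact .projPair (.refl _) (.refl _)
  | psiProj => exact .projPsiPair (.refl _) (.refl _)
  | sec => exact .secLit
  | oinj ht hv => exact ht ▸ hv ▸ .oinjBox
  | omatch h₁ h₂ => exact .omatchBox h₁ h₂ (.refl _) (.refl _)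

theorem Step.pared {e e' : Exp} (h : Step S e e') : Pared S e e' := by
  refine h.induction_frame (P := Pared S) (fun h => h.pared) fun hF _ ih => ?_
  exact (hF.congr Pared.refl ih).pared

theorem Judg.exists_of_frame {F : Exp → Exp} (hF : EvalFrame F) {G : Ctx} {e : Exp} {c : Cls}
    (h : Judg S G (F e) c) : ∃ c', Judg S G e c' := by
  generalize he : F e = x at h
  induction h with
  | kSub _ _ ih => exact ih he
  | tConv _ _ _ ih => exact ih he
  | _ => cases hF <;> injection he <;> exact ⟨_, by subst_vars; assumption⟩

theorem EvalFrame.unique {F F' : Exp → Exp} (hF : EvalFrame F) (hF' : EvalFrame F')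
    {x x' y y' : Exp} (hx : Step S x x') (hy : Step S y y') (h : F x = F' y) :
    F = F' ∧ x = y := by
  cases hF <;> cases hF' <;> grind [Value.not_step, OTy.not_step]

theorem HeadStep.ne_frame {e e' x x' : Exp} (h : HeadStep S e e') {F : Exp → Exp}
    (hF : EvalFrame F) (hx : Step S x x') : e ≠ F x := by
  cases h <;> cases hF <;> grind [Value, Value.not_step, OTy.not_step, OVal.value_toExp]

theorem EvalFrame.exists_of_indist {F : Exp → Exp} (hF : EvalFrame F) {e y : Exp}
    (h : Indist (F e) y) : ∃ F' e', EvalFrame F' ∧ y = F' e' ∧ Indist e e' ∧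
      ∀ {x x'}, Indist x x' → Indist (F x) (F' x') := by
  match hF, h with
  | .prod₁ _, .prod h h₁ => exact ⟨_, _, .prod₁ _, rfl, h, (.prod · h₁)⟩
  | .prod₂ w, .prod h₁ h => exact ⟨_, _, w.eq_of_indist h₁ ▸ .prod₂ w, rfl, h, .prod h₁⟩
  | .osum₁ _, .osum h h₁ => exact ⟨_, _, .osum₁ _, rfl, h, (.osum · h₁)⟩
  | .osum₂ w, .osum h₁ h => exact ⟨_, _, w.eq_of_indist h₁ ▸ .osum₂ w, rfl, h, .osum h₁⟩
  | .letE _, .letE h h₁ => exact ⟨_, _, .letE _, rfl, h, (.letE · h₁)⟩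
  | .app₂ _, .app h₁ h => exact ⟨_, _, .app₂ _, rfl, h, .app h₁⟩
  | .app₁ hv, .app h h₁ => exact ⟨_, _, .app₁ (hv.indist h₁), rfl, h, (.app · h₁)⟩
  | .ctor _, .ctor _ h => exact ⟨_, _, .ctor _, rfl, h, .ctor _⟩
  | .oapp _, .oapp _ h => exact ⟨_, _, .oapp _, rfl, h, .oapp _⟩
  | .ite _ _, .ite h h₁ h₂ => exact ⟨_, _, .ite _ _, rfl, h, (.ite · h₁ h₂)⟩
  | .mux₀ _ _, .mux h h₁ h₂ => exact ⟨_, _, .mux₀ _ _, rfl, h, (.mux · h₁ h₂)⟩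
  | .mux₁ _ hv, .mux h₁ h h₂ => exact ⟨_, _, .mux₁ _ (hv.indist h₁), rfl, h, (.mux h₁ · h₂)⟩
  | .mux₂ hv hv', .mux h₁ h₂ h =>
    exact ⟨_, _, .mux₂ (hv.indist h₁) (hv'.indist h₂), rfl, h, .mux h₁ h₂⟩
  | .pair₁ _, .pair h h₁ => exact ⟨_, _, .pair₁ _, rfl, h, (.pair · h₁)⟩
  | .pair₂ hv, .pair h₁ h => exact ⟨_, _, .pair₂ (hv.indist h₁), rfl, h, .pair h₁⟩
  | .psiPair₁ _, .psiPair h h₁ => exact ⟨_, _, .psiPair₁ _, rfl, h, (.psiPair · h₁)⟩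
  | .psiPair₂ hv, .psiPair h₁ h => exact ⟨_, _, .psiPair₂ (hv.indist h₁), rfl, h, .psiPair h₁⟩
  | .proj _, .proj _ h => exact ⟨_, _, .proj _, rfl, h, .proj _⟩
  | .oinj₁ _ _, .oinj _ h h₁ => exact ⟨_, _, .oinj₁ _ _, rfl, h, (.oinj _ · h₁)⟩
  | .oinj₂ b w, .oinj _ h₁ h =>
    exact ⟨_, _, w.eq_of_indist h₁ ▸ .oinj₂ b w, rfl, h, .oinj _ h₁⟩
  | .omatch _ _, .omatch h h₁ h₂ => exact ⟨_, _, .omatch _ _, rfl, h, (.omatch · h₁ h₂)⟩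
  | .cases _ _ _, .cases _ _ h h₁ => exact ⟨_, _, .cases _ _ _, rfl, h, (.cases _ _ · h₁)⟩
  | .sec, .sec h => exact ⟨_, _, .sec, rfl, h, .sec⟩

/-! ### Lockstep reduction -/

theorem HeadStep.of_step {e e' e'' : Exp} (h : HeadStep S e e') (hs : Step S e e'') :
    HeadStep S e e'' :=
  hs.induction_frame (P := fun e e'' => ∀ {e'}, HeadStep S e e' → HeadStep S e e'')
    (fun h _ _ => h) (fun hF hs _ _ h => absurd rfl (h.ne_frame hF hs)) h

theorem EvalFrame.exists_of_step {F : Exp → Exp} (hF : EvalFrame F) {e e' x : Exp}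
    (h : Step S e e') (hx : Step S (F e) x) : ∃ e'', Step S e e'' ∧ x = F e'' := by
  refine hx.induction_frame (P := fun y x => y = F e → ∃ e'', Step S e e'' ∧ x = F e'')
    (fun hy hF' => absurd hF' (hy.ne_frame hF h)) (fun hF' hy _ heq => ?_) rfl
  obtain ⟨rfl, rfl⟩ := hF'.unique hF hy h heq
  exact ⟨_, hy, rfl⟩

theorem HeadStep.exists_of_indist {e₁ e₁' e₂ : Exp} (h : HeadStep S e₁ e₁')
    (hi : Indist e₁ e₂) : ∃ e₂', HeadStep S e₂ e₂' := by
  match h, hi with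
  | .fn h, .gfun _ => exact ⟨_, .fn h⟩
  | .oadt h hv, .oapp _ i => exact ⟨_, .oadt h (hv.indist i)⟩
  | .app hv, .app (.lam _ _) i => exact ⟨_, .app (hv.indist i)⟩
  | .letE hv, .letE i _ => exact ⟨_, .letE (hv.indist i)⟩
  | .ite, .ite (.lit _) _ _ => exact ⟨_, .ite⟩
  | .mux hv₁ hv₂, .mux (.boxLit _ _) i₁ i₂ => exact ⟨_, .mux (hv₁.indist i₁) (hv₂.indist i₂)⟩
  | .cases rfl hv, .cases _ _ (.ctor _ i) _ => exact ⟨_, .cases rfl (hv.indist i)⟩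
  | .proj hv₁ hv₂, .proj _ (.pair i₁ i₂) => exact ⟨_, .proj (hv₁.indist i₁) (hv₂.indist i₂)⟩
  | .psiProj hv₁ hv₂, .proj _ (.psiPair i₁ i₂) =>
    exact ⟨_, .psiProj (hv₁.indist i₁) (hv₂.indist i₂)⟩
  | .sec, .sec (.lit _) => exact ⟨_, .sec⟩
  | .oinj rfl rfl, .oinj _ iw iu =>
    obtain ⟨_, hu⟩ := OVal.exists_of_indist iu
    exact ⟨_, .oinj (OTy.eq_of_indist iw) hu⟩
  | .omatch (w₁ := w₁) (w₂ := w₂) _ _, .omatch (.boxInj _ _ _ _ _) _ _ =>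
    obtain ⟨_, h₁⟩ := w₁.exists_ovalTy
    obtain ⟨_, h₂⟩ := w₂.exists_ovalTy
    exact ⟨_, .omatch h₁ h₂⟩

theorem Judg.ovalTy_of_omatch {G : Ctx} {b : Bool} {w : OTy} {u : OVal} {e₁ e₂ : Exp} {c : Cls}
    (h : Judg S G (.omatch (.boxInj b w u) e₁ e₂) c) : OValTy (.boxInj b w u) w := by
  obtain ⟨t | k, h⟩ := h.exists_of_frame (.omatch _ _)
  · exact h.inv.1
  · exact h.inv.elim

theorem HeadStep.indist_mux (hS : S.Ok) {G : Ctx} (hG : WfCtx S G) {b b' : Bool}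
    {v₁ v₁' v₂ v₂' : Exp} {c : Cls} (h : Judg S G (.mux (.boxLit b) v₁ v₂) c) (hv₁ : Value v₁)
    (hv₂ : Value v₂) (i₁ : Indist v₁ v₁') (i₂ : Indist v₂ v₂') :
    Indist (cond b v₁ v₂) (cond b' v₁' v₂') := by
  obtain ⟨t, ht, h₁, h₂⟩ := h.inv
  have hi : Indist v₁ v₂ := hv₁.indist_of_hasKind hS hG hv₂ ht h₁ h₂
  cases b <;> cases b'
  exacts [i₂, hi.symm.trans i₁, hi.trans i₂, i₁]

theorem HeadStep.indist_omatch {w₁ w₂ : OTy} {u u' u₁ u₁' u₂ u₂' : OVal} {b b' : Bool}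
    (h : OValTy (.boxInj b (.osum w₁ w₂) u) (.osum w₁ w₂))
    (h' : OValTy (.boxInj b' (.osum w₁ w₂) u') (.osum w₁ w₂))
    (h₁ : OValTy u₁ w₁) (h₁' : OValTy u₁' w₁) (h₂ : OValTy u₂ w₂) (h₂' : OValTy u₂' w₂)
    {e₁ e₁' e₂ e₂' : Exp} (i₁ : Indist e₁ e₁') (i₂ : Indist e₂ e₂') :
    Indist
      (.mux (.boxLit b) (cond b (e₁.inst u.toExp) (e₁.inst u₁.toExp))
        (cond b (e₂.inst u₂.toExp) (e₂.inst u.toExp)))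
      (.mux (.boxLit b') (cond b' (e₁'.inst u'.toExp) (e₁'.inst u₁'.toExp))
        (cond b' (e₂'.inst u₂'.toExp) (e₂'.inst u'.toExp))) := by
  cases h with | osum hu
  cases h' with | osum hu'
  cases b <;> cases b' <;>
    exact .mux (.boxLit _ _) (i₁.inst (OValTy.indist ‹_› ‹_›)) (i₂.inst (OValTy.indist ‹_› ‹_›))

theorem HeadStep.indist (hS : S.Ok) {G₁ G₂ : Ctx} (hG₁ : WfCtx S G₁) {e₁ e₁' e₂ e₂' : Exp}
    {c₁ c₂ : Cls} (h₁ : Judg S G₁ e₁ c₁) (h₂ : Judg S G₂ e₂ c₂) (hi : Indist e₁ e₂)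
    (hs₁ : HeadStep S e₁ e₁') (hs₂ : HeadStep S e₂ e₂') : Indist e₁' e₂' := by
  match hs₁, hi, hs₂ with
  | .fn h, .gfun _, .fn h' => cases h.symm.trans h'; exact .refl _
  | .oadt h _, .oapp _ i, .oadt h' _ => cases h.symm.trans h'; exact .inst (.refl _) i
  | .app _, .app (.lam _ i) i', .app _ => exact i.inst i'
  | .letE _, .letE i i', .letE _ => exact i'.inst i
  | .ite, .ite (.lit b) i i', .ite => exact i.cond i' b
  | .mux hv₁ hv₂, .mux (.boxLit _ _) i₁ i₂, .mux _ _ =>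
    exact indist_mux hS hG₁ h₁ hv₁ hv₂ i₁ i₂
  | .cases rfl _, .cases _ C (.ctor _ i) is, .cases hc _ =>
    injection hc with hc hv
    cases hv
    cases C.injective hc
    exact (is _).inst i
  | .proj _ _, .proj b (.pair i i'), .proj _ _ => exact i.cond i' b
  | .psiProj _ _, .proj b (.psiPair i i'), .psiProj _ _ => exact i.cond i' b
  | .sec, .sec (.lit _), .sec => exact .refl _
  | .oinj rfl _, .oinj _ i _, .oinj ht _ =>
    cases OTy.toExp_injective ((OTy.eq_of_indist i).symm.trans ht)
    exact .boxInj _ _ _ _ _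
  | .omatch h₁₁ h₁₂, .omatch (.boxInj _ _ _ _ _) i₁ i₂, .omatch h₂₁ h₂₂ =>
    exact indist_omatch h₁.ovalTy_of_omatch h₂.ovalTy_of_omatch h₁₁ h₂₁ h₁₂ h₂₂ i₁ i₂

theorem Step.exists_of_indist {e₁ e₁' e₂ : Exp} (h : Step S e₁ e₁') (hi : Indist e₁ e₂) :
    ∃ e₂', Step S e₂ e₂' := by
  refine h.induction_frame (P := fun e₁ _ => ∀ {e₂}, Indist e₁ e₂ → ∃ e₂', Step S e₂ e₂')
    (fun h _ hi => ?_) (fun hF _ ih _ hi => ?_) hi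
  · obtain ⟨_, h'⟩ := h.exists_of_indist hi
    exact ⟨_, h'.step⟩
  · obtain ⟨_, _, hF', rfl, hi, -⟩ := hF.exists_of_indist hi
    obtain ⟨_, h'⟩ := ih hi
    exact ⟨_, hF'.step h'⟩

theorem Step.indist (hS : S.Ok) {G₁ G₂ : Ctx} (hG₁ : WfCtx S G₁) {e₁ e₁' e₂ e₂' : Exp}
    {c₁ c₂ : Cls} (h₁ : Judg S G₁ e₁ c₁) (h₂ : Judg S G₂ e₂ c₂) (hi : Indist e₁ e₂)
    (hs₁ : Step S e₁ e₁') (hs₂ : Step S e₂ e₂') : Indist e₁' e₂' := by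
  refine hs₁.induction_frame (P := fun e₁ e₁' => ∀ {c₁ c₂ e₂ e₂'}, Judg S G₁ e₁ c₁ →
    Judg S G₂ e₂ c₂ → Indist e₁ e₂ → Step S e₂ e₂' → Indist e₁' e₂')
    (fun hs₁ _ _ _ _ h₁ h₂ hi hs₂ => ?_) (fun hF hs₁ ih _ _ _ _ h₁ h₂ hi hs₂ => ?_) h₁ h₂ hi hs₂
  · obtain ⟨_, h⟩ := hs₁.exists_of_indist hi
    exact hs₁.indist hS hG₁ h₁ h₂ hi (h.of_step hs₂)
  · obtain ⟨_, _, hF', rfl, hi, hFF'⟩ := hF.exists_of_indist hi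
    obtain ⟨_, h⟩ := hs₁.exists_of_indist hi
    obtain ⟨_, h', rfl⟩ := hF'.exists_of_step h hs₂
    obtain ⟨_, h₁⟩ := h₁.exists_of_frame hF
    obtain ⟨_, h₂⟩ := h₂.exists_of_frame hF'
    exact hFF' (ih h₁ h₂ hi h')

theorem Judg.step (hS : S.Ok) {G : Ctx} (hG : WfCtx S G) {e e' : Exp} {c : Cls}
    (h : Judg S G e c) (hs : Step S e e') : Judg S G e' c :=
  h.pared hS hG hs.pared

theorem StepN.exists_of_indist (hS : S.Ok) {G₁ G₂ : Ctx} (hG₁ : WfCtx S G₁) (hG₂ : WfCtx S G₂)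
    {n : ℕ} {e₁ e₁' e₂ : Exp} {c₁ c₂ : Cls} (h₁ : Judg S G₁ e₁ c₁) (h₂ : Judg S G₂ e₂ c₂)
    (hi : Indist e₁ e₂) (hs : StepN S n e₁ e₁') : ∃ e₂', StepN S n e₂ e₂' := by
  induction hs generalizing e₂ with
  | zero => exact ⟨_, .zero _⟩
  | succ hs₁ _ ih =>
    obtain ⟨_, hs₂⟩ := hs₁.exists_of_indist hi
    obtain ⟨_, h⟩ := ih (h₁.step hS hG₁ hs₁) (h₂.step hS hG₂ hs₂)
      (hs₁.indist hS hG₁ h₁ h₂ hi hs₂)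
    exact ⟨_, .succ hs₂ h⟩

theorem StepN.indist (hS : S.Ok) {G₁ G₂ : Ctx} (hG₁ : WfCtx S G₁) (hG₂ : WfCtx S G₂)
    {n : ℕ} {e₁ e₁' e₂ e₂' : Exp} {c₁ c₂ : Cls} (h₁ : Judg S G₁ e₁ c₁) (h₂ : Judg S G₂ e₂ c₂)
    (hi : Indist e₁ e₂) (hs₁ : StepN S n e₁ e₁') (hs₂ : StepN S n e₂ e₂') :
    Indist e₁' e₂' := by
  induction hs₁ generalizing e₂ with
  | zero => cases hs₂; exact hi
  | succ hs₁ _ ih =>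
    cases hs₂ with
    | succ hs₂ hs₂' =>
      exact ih (h₁.step hS hG₁ hs₁) (h₂.step hS hG₂ hs₂) (hs₁.indist hS hG₁ h₁ h₂ hi hs₂) hs₂'

end OADT

theorem theorem1_general (S : OADT.GCtx) (hS : S.Ok) {G₁ G₂ : OADT.Ctx}
    (hG₁ : OADT.WfCtx S G₁) (hG₂ : OADT.WfCtx S G₂) (e₁ e₂ : OADT.Exp) (c₁ c₂ : OADT.Cls)
    (hind : OADT.Indist e₁ e₂)
    (h₁ : OADT.Judg S G₁ e₁ c₁) (h₂ : OADT.Judg S G₂ e₂ c₂) (n : ℕ) :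
    ((∃ e₁', OADT.StepN S n e₁ e₁') ↔ ∃ e₂', OADT.StepN S n e₂ e₂') ∧
      ∀ e₁' e₂', OADT.StepN S n e₁ e₁' → OADT.StepN S n e₂ e₂' → OADT.Indist e₁' e₂' :=
  ⟨⟨fun ⟨_, hs⟩ => hs.exists_of_indist hS hG₁ hG₂ h₁ h₂ hind,
      fun ⟨_, hs⟩ => hs.exists_of_indist hS hG₂ hG₁ h₂ h₁ hind.symm⟩,
    fun _ _ hs₁ hs₂ => hs₁.indist hS hG₁ hG₂ h₁ h₂ hind hs₂⟩

theorem theorem1 (S : OADT.GCtx) (hS : S.Ok) (e₁ e₂ t₁ t₂ : OADT.Exp)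
    (hind : OADT.Indist e₁ e₂)
    (h₁ : OADT.HasType S [] e₁ t₁) (h₂ : OADT.HasType S [] e₂ t₂) (n : ℕ) :
    ((∃ e₁', OADT.StepN S n e₁ e₁') ↔ ∃ e₂', OADT.StepN S n e₂ e₂') ∧
      ∀ e₁' e₂', OADT.StepN S n e₁ e₁' → OADT.StepN S n e₂ e₂' → OADT.Indist e₁' e₂' := by
  exact theorem1_general S hS .nil .nil e₁ e₂ _ _ hind h₁ h₂ n
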